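/- For $a>-1$ put $A_0^{a}=1$ and $A_n^{a}=\frac{(a+1)(a+2)\cdots(a+n)}{n!}$ for $n\ge 1$, and let $\log^+x=\max\{\log x,1\}$ for $x\ge 0$ (so $\log^+0=1$). Let $0<\alpha\le\beta\le1$, let $\{X_{k,l}:k,l\ge0\}$ be independent, identically distributed real random variables, let $X$ be a random variable with their common distribution, and let $\mu\in\mathbb R$. Then the field converges completely to $\mu$ in the sense of its $(C,\alpha,\beta)$-means, i.e. $$\sum_{m=0}^\infty\sum_{n=0}^\infty P\Big(\Big|\sum_{k=0}^{m}\sum_{l=0}^{n}A_{m-k}^{\alpha-1}A_{n-l}^{\beta-1}X_{k,l}-A_m^{\alpha}A_n^{\beta}\mu\Big|>A_m^{\alpha}A_n^{\beta}\varepsilon\Big)<\infty\quad\text{for every }\varepsilon>0,$$ if and only if $E|X|<\infty$, $E\,X=\mu$, and $$\begin{cases} E|X|^{1/\alpha}<\infty, & \text{if } 0<\alpha<\tfrac12,\ \alpha<\beta\le1,\\ E|X|^{1/\alpha}\log^+|X|<\infty, & \text{if } 0<\alpha=\beta<\tfrac12,\\ E|X|^2(\log^+|X|)^3<\infty, & \text{if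 } \alpha=\beta=\tfrac12,\\ E|X|^2(\log^+|X|)^2<\infty, & \text{if } \alpha=\tfrac12<\beta\le1,\\ E|X|^2\log^+|X|<\infty, & \text{if } \tfrac12<\alpha\le\beta\le1. \end{cases}$$ -/

import Mathlib

open MeasureTheory ProbabilityTheory

/-- The Cesàro numbers `A_n^a = (a+1)(a+2)⋯(a+n) / n!`, with `A_0^a = 1`. -/
noncomputable def cesaroA (a : ℝ) (n : ℕ) : ℝ :=
  (∏ i ∈ Finset.range n, (a + ((i : ℝ) + 1))) / (n.factorial : ℝ)

/-- The convention `log⁺ x = max {log x, 1}` (on `x ≥ 0`, with value `1` at `x = 0`). -/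
noncomputable def logPlus (x : ℝ) : ℝ := max (Real.log x) 1

/-- The weighted sum `∑_{k=0}^m ∑_{l=0}^n A_{m-k}^{α-1} A_{n-l}^{β-1} x_{k,l}`. -/
noncomputable def cesaroSum (α β : ℝ) (x : ℕ → ℕ → ℝ) (m n : ℕ) : ℝ :=
  ∑ k ∈ Finset.range (m + 1), ∑ l ∈ Finset.range (n + 1),
    cesaroA (α - 1) (m - k) * cesaroA (β - 1) (n - l) * x k l

/-- Complete convergence of the `(C, α, β)`-means of the random field `X` to the number `c`:
the probabilities of deviations larger than `ε` are summable over all `m, n ≥ 0`,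
for every `ε > 0`. -/
def CesaroConvergesCompletely {Ω : Type*} [MeasurableSpace Ω] (P : Measure Ω) (α β : ℝ)
    (X : ℕ → ℕ → Ω → ℝ) (c : ℝ) : Prop :=
  ∀ ε : ℝ, 0 < ε →
    ∑' p : ℕ × ℕ, P {ω | |cesaroSum α β (fun k l => X k l ω) p.1 p.2
        - cesaroA α p.1 * cesaroA β p.2 * c| > cesaroA α p.1 * cesaroA β p.2 * ε} < ⊤

/-! After division by `A_m^α A_n^β` the mean has positive weights of total mass one. With `i = m -
k` and `j = n - l`, each weight is comparable to `1 / (s t)`, where `s = (m+1)^α (i+1)^(1-α)` and `t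
= (n+1)^β (j+1)^(1-β)`. Complete convergence amounts to summability, over all means and all their
summands, of the probabilities that a single weighted summand is large. By Tonelli this sum is `E
(weightCount α β (|X| / c))`, so the moment condition is the growth rate of a lattice point count.

Sufficiency: every weight is at most a constant times `B^(-α)`, with `B = (m+1)(n+1)`. A Chernoff
bound for the truncated summands therefore leaves an error `O(B^(-2))`, which is summable
(`measure_weighted_sum_gt_le`, `chernoff_exponent_le`). Necessity: a large summand, with the other
summands near the limit, forces a deviation, and a second moment argument turns this into a bound
for the sum of the tails (`sum_measureReal_le_of_sum_deviation`). The moment then gives convergence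
to `E X`, and limits are unique.

Counting: the pairs with `s < y` number about `y^(1/α) ∑_{i<y} (i+1)^(1-1/α)`. That sum is bounded,
logarithmic or a power according as `α` is below, at or above `1/2`. Summing over the second pair
adds the remaining logarithms. The growth exponent is always at least 2, so the Chernoff step has a
second moment at its disposal. -/

open scoped ENNReal

/-! ### Truncated power sums. -/

/-- The truncated sum `∑_{n + 1 < z} (n + 1)^{-s}`. -/
noncomputable def powSum (s z : ℝ) : ℝ≥0∞ :=
  ∑' n : ℕ, if (n : ℝ) + 1 < z then ENNReal.ofReal (((n : ℝ) + 1) ^ (-s)) else 0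

/-- The strict inequality `n + 1 < z` makes the cutoff `⌈z⌉₊ - 1` rather than a floor; natural
subtraction covers `z ≤ 0`. -/
lemma powSum_eq (s z : ℝ) :
    powSum s z = ENNReal.ofReal (∑ n ∈ Finset.range (⌈z⌉₊ - 1), ((n : ℝ) + 1) ^ (-s)) := by
  rw [powSum, ENNReal.ofReal_sum_of_nonneg (fun n _ => by positivity),
    tsum_eq_sum (s := Finset.range (⌈z⌉₊ - 1))]
  · refine Finset.sum_congr rfl fun n hn => if_pos ?_
    have h : n + 1 < ⌈z⌉₊ := by have := Finset.mem_range.1 hn; omega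
    exact_mod_cast Nat.lt_ceil.1 h
  · intro n hn
    refine if_neg fun h => hn (Finset.mem_range.2 ?_)
    have : n + 1 < ⌈z⌉₊ := Nat.lt_ceil.2 (by exact_mod_cast h)
    omega

lemma natCeil_sub_one_le {z : ℝ} (hz : 0 ≤ z) : ((⌈z⌉₊ - 1 : ℕ) : ℝ) ≤ z := by
  have h := Nat.ceil_lt_add_one hz
  rcases Nat.eq_zero_or_pos ⌈z⌉₊ with h0 | h0
  · rw [h0]; simpa using hz
  · rw [Nat.cast_pred h0]; linarith

lemma le_natCeil_sub_one_add_one (z : ℝ) : z ≤ ((⌈z⌉₊ - 1 : ℕ) : ℝ) + 1 := by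
  have h := Nat.le_ceil z
  have h' : ⌈z⌉₊ ≤ ⌈z⌉₊ - 1 + 1 := by omega
  have : (⌈z⌉₊ : ℝ) ≤ ((⌈z⌉₊ - 1 : ℕ) : ℝ) + 1 := by exact_mod_cast h'
  linarith

lemma one_le_natCeil_sub_one {z : ℝ} (hz : 1 < z) : 1 ≤ ((⌈z⌉₊ - 1 : ℕ) : ℝ) := by
  have h : 1 < ⌈z⌉₊ := Nat.lt_ceil.2 (by simpa using hz)
  have : 1 ≤ ⌈z⌉₊ - 1 := by omega
  exact_mod_cast this

lemma powSum_zero_eq (z : ℝ) : powSum 0 z = ENNReal.ofReal ((⌈z⌉₊ - 1 : ℕ) : ℝ) := by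
  rw [powSum_eq]; simp

lemma powSum_zero_le (z : ℝ) : powSum 0 z ≤ ENNReal.ofReal z := by
  rcases le_or_gt 0 z with hz | hz
  · rw [powSum_zero_eq]; exact ENNReal.ofReal_le_ofReal (natCeil_sub_one_le hz)
  · rw [powSum_zero_eq, Nat.ceil_eq_zero.2 hz.le]; simp

lemma ofReal_half_le_powSum_zero {z : ℝ} (hz : 1 < z) :
    ENNReal.ofReal (z / 2) ≤ powSum 0 z := by
  rw [powSum_zero_eq]
  refine ENNReal.ofReal_le_ofReal ?_
  have h1 := le_natCeil_sub_one_add_one z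
  have h2 := one_le_natCeil_sub_one hz
  linarith

lemma ofReal_sub_one_le_powSum_zero (z : ℝ) : ENNReal.ofReal (z - 1) ≤ powSum 0 z := by
  rw [powSum_zero_eq]
  refine ENNReal.ofReal_le_ofReal ?_
  linarith [le_natCeil_sub_one_add_one z]

lemma ofReal_sq_le_powSum_neg_one {z : ℝ} (hz : 1 < z) :
    ENNReal.ofReal (z ^ 2 / 4) ≤ powSum (-1) z := by
  rw [powSum_eq]
  refine ENNReal.ofReal_le_ofReal ?_
  have key : ∀ N : ℕ, ∑ n ∈ Finset.range N, ((n : ℝ) + 1) ^ (-(-1 : ℝ)) = N * (N + 1) / 2 := by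
    intro N
    induction N with
    | zero => simp
    | succ N ih => rw [Finset.sum_range_succ, ih]; simp; ring
  rw [key]
  have h1 := le_natCeil_sub_one_add_one z
  have h2 := one_le_natCeil_sub_one hz
  nlinarith

lemma sum_inv_eq_harmonic (N : ℕ) :
    ∑ n ∈ Finset.range N, ((n : ℝ) + 1) ^ (-1 : ℝ) = ((harmonic N : ℚ) : ℝ) := by
  simp [harmonic, Real.rpow_neg_one]

lemma powSum_one_le {z : ℝ} (hz : 1 ≤ z) : powSum 1 z ≤ ENNReal.ofReal (1 + Real.log z) := by
  rw [powSum_eq, sum_inv_eq_harmonic]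
  refine ENNReal.ofReal_le_ofReal ((harmonic_le_one_add_log _).trans ?_)
  have h := natCeil_sub_one_le (zero_le_one.trans hz)
  rcases Nat.eq_zero_or_pos (⌈z⌉₊ - 1) with h0 | h0
  · rw [h0]; simpa using Real.log_nonneg hz
  · have : (0 : ℝ) < ((⌈z⌉₊ - 1 : ℕ) : ℝ) := by exact_mod_cast h0
    linarith [Real.log_le_log this h]

lemma ofReal_log_le_powSum_one {z : ℝ} (hz : 0 < z) :
    ENNReal.ofReal (Real.log z) ≤ powSum 1 z := by
  rw [powSum_eq, sum_inv_eq_harmonic]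
  refine ENNReal.ofReal_le_ofReal (le_trans ?_ (log_add_one_le_harmonic _))
  refine Real.log_le_log hz ?_
  have := le_natCeil_sub_one_add_one z
  push_cast
  exact this

lemma tsum_ofReal_rpow_ne_top {s : ℝ} (hs : 1 < s) :
    ∑' n : ℕ, ENNReal.ofReal (((n : ℝ) + 1) ^ (-s)) ≠ ∞ := by
  have h : Summable fun n : ℕ => ((n : ℝ) + 1) ^ (-s) := by
    have := (summable_nat_add_iff 1).2 (Real.summable_nat_rpow.2 (by linarith : -s < -1))
    simpa using this
  exact h.tsum_ofReal_ne_top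

lemma powSum_le_tsum (s z : ℝ) :
    powSum s z ≤ ∑' n : ℕ, ENNReal.ofReal (((n : ℝ) + 1) ^ (-s)) :=
  ENNReal.tsum_le_tsum fun n => by split_ifs <;> simp

lemma powSum_le_rpow {s z : ℝ} (hs0 : 0 ≤ s) (hs : s < 1) (hz : 0 ≤ z) :
    powSum s z ≤ ENNReal.ofReal (z ^ (1 - s) / (1 - s)) := by
  have ht : 0 < 1 - s := by linarith
  have key : ∀ N : ℕ, ∑ n ∈ Finset.range N, ((n : ℝ) + 1) ^ (-s) ≤ (N : ℝ) ^ (1 - s) / (1 - s) := by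
    intro N
    induction N with
    | zero => simp [Real.zero_rpow ht.ne']
    | succ N ih =>
      rw [Finset.sum_range_succ]
      have hN : (0 : ℝ) < (N : ℝ) + 1 := by positivity
      -- Bernoulli's inequality for an exponent in `[0, 1]` is a discrete form of the comparison
      -- with `∫ u^(-s)`.
      have hb : (1 + -(1 / ((N : ℝ) + 1))) ^ (1 - s) ≤ 1 + (1 - s) * -(1 / ((N : ℝ) + 1)) := by
        refine rpow_one_add_le_one_add_mul_self ?_ ht.le (by linarith)
        have : 1 / ((N : ℝ) + 1) ≤ 1 := by
          rw [div_le_one hN]; linarith [(Nat.cast_nonneg N : (0 : ℝ) ≤ N)]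
        linarith
      have e1 : (N : ℝ) ^ (1 - s)
          = ((N : ℝ) + 1) ^ (1 - s) * (1 + -(1 / ((N : ℝ) + 1))) ^ (1 - s) := by
        have h1 : 1 + -(1 / ((N : ℝ) + 1)) = N / (N + 1) := by field_simp; ring
        rw [h1, ← Real.mul_rpow hN.le (by positivity)]
        congr 1; field_simp
      have e2 : ((N : ℝ) + 1) ^ (1 - s) = ((N : ℝ) + 1) ^ (-s) * ((N : ℝ) + 1) := by
        rw [← Real.rpow_add_one hN.ne']; ring_nf
      have h3 : (N : ℝ) ^ (1 - s) ≤ ((N : ℝ) + 1) ^ (1 - s) - (1 - s) * ((N : ℝ) + 1) ^ (-s) := by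
        rw [e1]
        refine (mul_le_mul_of_nonneg_left hb (by positivity)).trans_eq ?_
        rw [e2]; field_simp; ring
      have h4 : (N : ℝ) ^ (1 - s) / (1 - s) + ((N : ℝ) + 1) ^ (-s)
          ≤ ((N : ℝ) + 1) ^ (1 - s) / (1 - s) := by
        rw [div_add' _ _ _ ht.ne']
        exact div_le_div_of_nonneg_right (by linarith) ht.le
      push_cast
      linarith
  rw [powSum_eq]
  refine ENNReal.ofReal_le_ofReal ((key _).trans ?_)
  gcongr
  exact natCeil_sub_one_le hz

/-! ### Reciprocal weights and their counting functions. -/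

/-- The reciprocal size `(m + 1)^a (i + 1)^{1 - a}` of the Cesàro weight `A_i^{a-1} / A_m^a`. -/
noncomputable def invWeight (a : ℝ) (m i : ℕ) : ℝ := ((m : ℝ) + 1) ^ a * ((i : ℝ) + 1) ^ (1 - a)

lemma invWeight_pos (a : ℝ) (m i : ℕ) : 0 < invWeight a m i := by
  unfold invWeight; positivity

lemma rpow_le_invWeight {a : ℝ} (ha1 : a ≤ 1) (m i : ℕ) :
    ((m : ℝ) + 1) ^ a ≤ invWeight a m i := by
  unfold invWeight
  refine le_mul_of_one_le_right (by positivity) (Real.one_le_rpow ?_ (by linarith))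
  linarith [(Nat.cast_nonneg i : (0 : ℝ) ≤ i)]

lemma one_le_invWeight {a : ℝ} (ha : 0 < a) (ha1 : a ≤ 1) (m i : ℕ) : 1 ≤ invWeight a m i :=
  le_trans (Real.one_le_rpow (by linarith [(Nat.cast_nonneg m : (0 : ℝ) ≤ m)]) ha.le)
    (rpow_le_invWeight ha1 m i)

/-- The reciprocal weight is a weighted geometric mean of `m + 1` and `i + 1`, so it lies between
them; `invWeight_le` is the other side. -/
lemma le_invWeight {a : ℝ} (ha : 0 < a) {m i : ℕ} (h : i ≤ m) :
    (i : ℝ) + 1 ≤ invWeight a m i := by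
  have hi : (0 : ℝ) < (i : ℝ) + 1 := by positivity
  have him : (i : ℝ) ≤ m := by exact_mod_cast h
  calc (i : ℝ) + 1 = ((i : ℝ) + 1) ^ a * ((i : ℝ) + 1) ^ (1 - a) := by
        rw [← Real.rpow_add hi]; simp
    _ ≤ _ := by unfold invWeight; gcongr

lemma invWeight_le {a : ℝ} (ha1 : a ≤ 1) {m i : ℕ} (h : i ≤ m) :
    invWeight a m i ≤ (m : ℝ) + 1 := by
  have hm : (0 : ℝ) < (m : ℝ) + 1 := by positivity
  have him : (i : ℝ) ≤ m := by exact_mod_cast h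
  calc invWeight a m i ≤ ((m : ℝ) + 1) ^ a * ((m : ℝ) + 1) ^ (1 - a) := by
        unfold invWeight
        have : 0 ≤ 1 - a := by linarith
        gcongr
    _ = _ := by rw [← Real.rpow_add hm]; simp

/-- Summation of `f` over the reciprocal weights with indices `i ≤ m`. -/
noncomputable def triSum (a : ℝ) (f : ℝ → ℝ≥0∞) : ℝ≥0∞ :=
  ∑' m : ℕ, ∑' i : ℕ, if i ≤ m then f (invWeight a m i) else 0

lemma triSum_mono {a : ℝ} (ha : 0 < a) (ha1 : a ≤ 1) {f g : ℝ → ℝ≥0∞}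
    (h : ∀ t, 1 ≤ t → f t ≤ g t) : triSum a f ≤ triSum a g := by
  refine ENNReal.tsum_le_tsum fun m => ENNReal.tsum_le_tsum fun i => ?_
  split_ifs
  · exact h _ (one_le_invWeight ha ha1 m i)
  · exact le_rfl

lemma triSum_mul_left (a : ℝ) (c : ℝ≥0∞) (f : ℝ → ℝ≥0∞) :
    triSum a (fun t => c * f t) = c * triSum a f := by
  simp only [triSum, ← ENNReal.tsum_mul_left, mul_ite, mul_zero]

lemma triSum_comm (a b : ℝ) (f : ℝ → ℝ → ℝ≥0∞) :
    triSum a (fun s => triSum b fun t => f s t) = triSum b (fun t => triSum a fun s => f s t) := by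
  have key : ∀ (a b : ℝ) (f : ℝ → ℝ → ℝ≥0∞), triSum a (fun s => triSum b fun t => f s t)
      = ∑' p : ℕ × ℕ, ∑' q : ℕ × ℕ, if p.2 ≤ p.1 ∧ q.2 ≤ q.1 then
          f (invWeight a p.1 p.2) (invWeight b q.1 q.2) else 0 := by
    intro a b f
    rw [triSum, ENNReal.tsum_prod']
    refine tsum_congr fun m => tsum_congr fun i => ?_
    by_cases h : i ≤ m
    · simp only [h, if_true, true_and]
      rw [triSum, ENNReal.tsum_prod']
    · simp [h]
  rw [key, key, ENNReal.tsum_comm]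
  simp only [and_comm]

/-- The number of quadruples `i ≤ m`, `j ≤ n` whose product of reciprocal weights is below `x`. -/
noncomputable def weightCount (a b x : ℝ) : ℝ≥0∞ :=
  triSum a fun s => triSum b fun t => if s * t < x then 1 else 0

lemma weightCount_comm (a b x : ℝ) : weightCount a b x = weightCount b a x := by
  unfold weightCount
  rw [triSum_comm]
  simp only [mul_comm]

/-- The number of pairs `i ≤ m` with reciprocal weight below `y`. -/
noncomputable def pairCount (a y : ℝ) : ℝ≥0∞ := triSum a fun t => if t < y then 1 else 0

lemma pairCount_eq_zero {a : ℝ} (ha : 0 < a) (ha1 : a ≤ 1) {y : ℝ} (hy : y ≤ 1) :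
    pairCount a y = 0 := by
  refine le_antisymm ((triSum_mono ha ha1 (g := fun _ => 0) fun t ht => ?_).trans ?_) zero_le
  · rw [if_neg (by linarith)]
  · simp [triSum]

/-- For fixed `i` the condition reads `m + 1 < y^(1/a) (i+1)^(1-1/a)`. The constraint `i ≤ m` is
used only to get `i + 1 < y`. -/
lemma pairCount_le {a : ℝ} (ha : 0 < a) {y : ℝ} (hy : 0 ≤ y) :
    pairCount a y ≤ ENNReal.ofReal (y ^ (1 / a)) * powSum (1 / a - 1) y := by
  rw [pairCount, triSum, ENNReal.tsum_comm, powSum, ← ENNReal.tsum_mul_left]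
  refine ENNReal.tsum_le_tsum fun i => ?_
  have hi : (0 : ℝ) < (i : ℝ) + 1 := by positivity
  by_cases hiy : (i : ℝ) + 1 < y
  · rw [if_pos hiy, ← ENNReal.ofReal_mul (by positivity)]
    refine le_trans ?_ (powSum_zero_le _)
    refine ENNReal.tsum_le_tsum fun m => ?_
    have hm : (0 : ℝ) < (m : ℝ) + 1 := by positivity
    split_ifs with h1 h2 h3
    · simp
    · exfalso
      apply h3
      unfold invWeight at h2
      have h4 : ((m : ℝ) + 1) ^ a < y * ((i : ℝ) + 1) ^ (a - 1) := by
        have : ((i : ℝ) + 1) ^ (a - 1) = (((i : ℝ) + 1) ^ (1 - a))⁻¹ := by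
          rw [← Real.rpow_neg hi.le]; ring_nf
        rw [this, ← div_eq_mul_inv, lt_div_iff₀ (by positivity)]
        exact h2
      have h5 := Real.rpow_lt_rpow (by positivity) h4 (by positivity : 0 < 1 / a)
      rw [← Real.rpow_mul hm.le, mul_one_div_cancel ha.ne', Real.rpow_one,
        Real.mul_rpow hy (by positivity), ← Real.rpow_mul hi.le] at h5
      convert h5 using 3
      field_simp
      ring
    · exact zero_le
    · exact zero_le
    · exact zero_le
    · exact zero_le
  · rw [if_neg hiy, mul_zero, nonpos_iff_eq_zero, ENNReal.tsum_eq_zero]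
    intro m
    split_ifs with h1 h2
    · exact absurd ((le_invWeight ha h1).trans_lt h2) hiy
    · rfl
    · rfl

lemma one_le_logPlus (x : ℝ) : 1 ≤ logPlus x := le_max_right _ _

lemma one_add_mul_log_le {c : ℝ} (hc : 0 ≤ c) (x : ℝ) :
    1 + c * Real.log x ≤ (1 + c) * logPlus x := by
  have h1 := one_le_logPlus x
  have h2 : Real.log x ≤ logPlus x := le_max_left _ _
  nlinarith

lemma weightCount_eq (a b x : ℝ) :
    weightCount a b x = triSum b fun t => pairCount a (x / t) := by
  unfold weightCount
  rw [triSum_comm]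
  rw [triSum, triSum]
  refine tsum_congr fun n => tsum_congr fun j => ?_
  simp only [pairCount, lt_div_iff₀ (invWeight_pos b n j)]

lemma weightCount_eq_zero {a b x : ℝ} (ha : 0 < a) (ha1 : a ≤ 1) (hb : 0 < b) (hb1 : b ≤ 1)
    (hx : x ≤ 1) : weightCount a b x = 0 := by
  rw [weightCount_eq]
  refine le_antisymm ((triSum_mono hb hb1 (g := fun _ => 0) fun t ht => ?_).trans ?_) zero_le
  · rw [pairCount_eq_zero ha ha1]
    rw [div_le_one (by linarith)]; linarith
  · simp [triSum]

/-- Counting the first pair at level `x / t` leaves a sum of `t^(-p)` over the second. Since `t ≥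
1`, only levels `y ≤ x` occur, so `K` may contain `log x`. -/
lemma weightCount_le_of_pairCount_le {a b x p : ℝ} (ha : 0 < a) (ha1 : a ≤ 1) (hb : 0 < b)
    (hb1 : b ≤ 1) (hx : 0 ≤ x) (K : ℝ≥0∞)
    (h : ∀ y, 1 ≤ y → y ≤ x → pairCount a y ≤ K * ENNReal.ofReal (y ^ p)) :
    weightCount a b x ≤ K * ENNReal.ofReal (x ^ p) *
      triSum b fun t => if t < x then ENNReal.ofReal (t ^ (-p)) else 0 := by
  rw [weightCount_eq, ← triSum_mul_left]
  refine triSum_mono hb hb1 fun t ht => ?_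
  have ht0 : 0 < t := by linarith
  split_ifs with htx
  · refine (h (x / t) ?_ ?_).trans_eq ?_
    · rw [le_div_iff₀ ht0]; linarith
    · exact div_le_self hx ht
    · rw [mul_assoc, ← ENNReal.ofReal_mul (by positivity), Real.div_rpow hx ht0.le,
        Real.rpow_neg ht0.le, div_eq_mul_inv]
  · rw [pairCount_eq_zero ha ha1]
    · exact zero_le
    · rw [div_le_one ht0]; linarith

lemma invWeight_rpow_neg (b p : ℝ) (m i : ℕ) :
    (invWeight b m i) ^ (-p)
      = ((m : ℝ) + 1) ^ (-(b * p)) * ((i : ℝ) + 1) ^ (-((1 - b) * p)) := by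
  unfold invWeight
  rw [Real.mul_rpow (by positivity) (by positivity), ← Real.rpow_mul (by positivity),
    ← Real.rpow_mul (by positivity)]
  ring_nf

lemma lt_rpow_of_invWeight_lt {b x : ℝ} (hb : 0 < b) (hb1 : b ≤ 1) {m i : ℕ}
    (h : invWeight b m i < x) : (m : ℝ) + 1 < x ^ (1 / b) := by
  have h1 := (rpow_le_invWeight hb1 m i).trans_lt h
  have hm : (0 : ℝ) < (m : ℝ) + 1 := by positivity
  have h2 := Real.rpow_lt_rpow (by positivity) h1 (by positivity : 0 < 1 / b)
  rwa [← Real.rpow_mul hm.le, mul_one_div_cancel hb.ne', Real.rpow_one] at h2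

/-- Forgetting `i ≤ m` decouples the two indices; `t < x` still truncates each of them. -/
lemma triSum_rpow_le_mul {b : ℝ} (hb : 0 < b) (hb1 : b ≤ 1) (p x : ℝ) :
    (triSum b fun t => if t < x then ENNReal.ofReal (t ^ (-p)) else 0)
      ≤ powSum (b * p) (x ^ (1 / b)) * powSum ((1 - b) * p) x := by
  unfold triSum powSum
  rw [← ENNReal.tsum_mul_right]
  refine ENNReal.tsum_le_tsum fun m => ?_
  rw [← ENNReal.tsum_mul_left]
  refine ENNReal.tsum_le_tsum fun i => ?_
  by_cases h1 : i ≤ m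
  · by_cases h2 : invWeight b m i < x
    · beta_reduce
      rw [if_pos h1, if_pos h2, if_pos (lt_rpow_of_invWeight_lt hb hb1 h2),
        if_pos ((le_invWeight hb h1).trans_lt h2), invWeight_rpow_neg,
        ENNReal.ofReal_mul (by positivity)]
    · simp [h2]
  · simp [h1]

/-- The exponent `(1 - b) p` of `i` may be below 1. As `i ≤ m`, the surplus `b p - r` can be moved
from `m + 1` to `i + 1`, after which both exponents are at least `r > 1`. -/
lemma triSum_rpow_ne_top {b p : ℝ} (hp : 2 < p) (hbp : 1 < b * p) :
    (triSum b fun t => ENNReal.ofReal (t ^ (-p))) ≠ ∞ := by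
  obtain ⟨r, hr1, hr2, hr3⟩ : ∃ r : ℝ, 1 < r ∧ 2 * r ≤ p ∧ r ≤ b * p := by
    refine ⟨min (p / 2) (b * p), lt_min (by linarith) hbp, ?_, min_le_right _ _⟩
    linarith [min_le_left (p / 2) (b * p)]
  refine ne_top_of_le_ne_top
    (ENNReal.mul_ne_top (tsum_ofReal_rpow_ne_top hr1) (tsum_ofReal_rpow_ne_top hr1)) ?_
  unfold triSum
  rw [← ENNReal.tsum_mul_right]
  refine ENNReal.tsum_le_tsum fun m => ?_
  rw [← ENNReal.tsum_mul_left]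
  refine ENNReal.tsum_le_tsum fun i => ?_
  split_ifs with h
  · beta_reduce
    rw [invWeight_rpow_neg, ← ENNReal.ofReal_mul (by positivity)]
    refine ENNReal.ofReal_le_ofReal ?_
    have hi : (0 : ℝ) < (i : ℝ) + 1 := by positivity
    have hm : (0 : ℝ) < (m : ℝ) + 1 := by positivity
    have him : (i : ℝ) ≤ m := by exact_mod_cast h
    calc ((m : ℝ) + 1) ^ (-(b * p)) * ((i : ℝ) + 1) ^ (-((1 - b) * p))
        = ((m : ℝ) + 1) ^ (-r) * ((m : ℝ) + 1) ^ (-(b * p - r))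
          * ((i : ℝ) + 1) ^ (-((1 - b) * p)) := by
          rw [← Real.rpow_add hm]; ring_nf
      _ ≤ ((m : ℝ) + 1) ^ (-r) * ((i : ℝ) + 1) ^ (-(b * p - r))
          * ((i : ℝ) + 1) ^ (-((1 - b) * p)) := by
          have := Real.rpow_le_rpow_of_nonpos hi (by linarith : (i : ℝ) + 1 ≤ (m : ℝ) + 1)
            (by linarith : -(b * p - r) ≤ 0)
          gcongr
      _ = ((m : ℝ) + 1) ^ (-r) * ((i : ℝ) + 1) ^ (-(p - r)) := by
          rw [mul_assoc, ← Real.rpow_add hi]; ring_nf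
      _ ≤ _ := by
          gcongr
          · linarith
          · linarith
  · exact zero_le

/-- Here `i ≤ m` must be kept: the inner sum is of order `(m+1)^(2b-1)`, which turns `(m+1)^(-2b)`
into `1 / (m+1)` and costs just one logarithm. -/
lemma triSum_rpow_two_le {b : ℝ} (hb : 1 / 2 < b) (hb1 : b ≤ 1) (x : ℝ) :
    (triSum b fun t => if t < x then ENNReal.ofReal (t ^ (-(2 : ℝ))) else 0)
      ≤ ENNReal.ofReal (2 / (2 * b - 1)) * powSum 1 (x ^ (1 / b)) := by
  unfold triSum
  rw [powSum, ← ENNReal.tsum_mul_left]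
  refine ENNReal.tsum_le_tsum fun m => ?_
  have hm : (0 : ℝ) < (m : ℝ) + 1 := by positivity
  by_cases h : (m : ℝ) + 1 < x ^ (1 / b)
  · rw [if_pos h]
    calc (∑' i : ℕ, if i ≤ m then
          (if invWeight b m i < x then ENNReal.ofReal (invWeight b m i ^ (-(2 : ℝ))) else 0) else 0)
        ≤ ∑' i : ℕ, ENNReal.ofReal (((m : ℝ) + 1) ^ (-(b * 2))) *
          (if (i : ℝ) + 1 < (m : ℝ) + 2 then
            ENNReal.ofReal (((i : ℝ) + 1) ^ (-((1 - b) * 2))) else 0) := by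
          refine ENNReal.tsum_le_tsum fun i => ?_
          split_ifs with h1 h2 h3 h3
          · rw [invWeight_rpow_neg, ENNReal.ofReal_mul (by positivity)]
          · have : (i : ℝ) ≤ m := by exact_mod_cast h1
            exact absurd (by linarith) h3
          all_goals exact zero_le
      _ = ENNReal.ofReal (((m : ℝ) + 1) ^ (-(b * 2))) * powSum ((1 - b) * 2) ((m : ℝ) + 2) := by
          rw [ENNReal.tsum_mul_left, powSum]
      _ ≤ ENNReal.ofReal (((m : ℝ) + 1) ^ (-(b * 2))) *
          ENNReal.ofReal (((m : ℝ) + 2) ^ (1 - (1 - b) * 2) / (1 - (1 - b) * 2)) := by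
          gcongr
          exact powSum_le_rpow (by linarith) (by linarith) (by positivity)
      _ ≤ _ := by
          rw [← ENNReal.ofReal_mul (by positivity), ← ENNReal.ofReal_mul
            (div_nonneg (by norm_num) (by linarith))]
          refine ENNReal.ofReal_le_ofReal ?_
          have e : 1 - (1 - b) * 2 = 2 * b - 1 := by ring
          rw [e]
          have h0 : 0 < 2 * b - 1 := by linarith
          have h2 : ((m : ℝ) + 2) ^ (2 * b - 1) ≤ 2 * ((m : ℝ) + 1) ^ (2 * b - 1) := by
            calc ((m : ℝ) + 2) ^ (2 * b - 1) ≤ (2 * ((m : ℝ) + 1)) ^ (2 * b - 1) := by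
                  gcongr; linarith
              _ = 2 ^ (2 * b - 1) * ((m : ℝ) + 1) ^ (2 * b - 1) :=
                  Real.mul_rpow (by norm_num) hm.le
              _ ≤ _ := by
                  gcongr
                  calc (2 : ℝ) ^ (2 * b - 1) ≤ 2 ^ (1 : ℝ) :=
                        Real.rpow_le_rpow_of_exponent_le (by norm_num) (by linarith)
                    _ = 2 := Real.rpow_one 2
          have h3 : ((m : ℝ) + 1) ^ (-(1 : ℝ))
              = ((m : ℝ) + 1) ^ (-(b * 2)) * ((m : ℝ) + 1) ^ (2 * b - 1) := by
            rw [← Real.rpow_add hm]; ring_nf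
          rw [h3]
          calc ((m : ℝ) + 1) ^ (-(b * 2)) * (((m : ℝ) + 2) ^ (2 * b - 1) / (2 * b - 1))
              ≤ ((m : ℝ) + 1) ^ (-(b * 2)) *
                ((2 * ((m : ℝ) + 1) ^ (2 * b - 1)) / (2 * b - 1)) := by gcongr
            _ = _ := by ring
  · rw [if_neg h, mul_zero, nonpos_iff_eq_zero, ENNReal.tsum_eq_zero]
    intro i
    beta_reduce
    split_ifs with h1 h2
    · exact absurd (lt_rpow_of_invWeight_lt (by linarith) hb1 h2) h
    · rfl
    · rfl

lemma powSum_one_rpow_le {x q : ℝ} (hx : 1 ≤ x) (hq : 0 ≤ q) :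
    powSum 1 (x ^ q) ≤ ENNReal.ofReal (1 + q) * ENNReal.ofReal (logPlus x) := by
  refine (powSum_one_le (Real.one_le_rpow hx hq)).trans ?_
  rw [← ENNReal.ofReal_mul (by linarith), Real.log_rpow (by linarith)]
  exact ENNReal.ofReal_le_ofReal (one_add_mul_log_le hq x)

lemma powSum_one_le_logPlus {x : ℝ} (hx : 1 ≤ x) :
    powSum 1 x ≤ ENNReal.ofReal 2 * ENNReal.ofReal (logPlus x) := by
  have := powSum_one_rpow_le hx (zero_le_one : (0 : ℝ) ≤ 1)
  rw [Real.rpow_one] at this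
  convert this using 3
  norm_num

/-! ### Upper bounds for the counts in the five regimes. -/

lemma pairCount_le_of_lt_half {a : ℝ} (ha : 0 < a) (h : a < 1 / 2) :
    ∃ C : ℝ≥0∞, C ≠ ∞ ∧ ∀ y, 1 ≤ y → pairCount a y ≤ C * ENNReal.ofReal (y ^ (1 / a)) := by
  have h1 : 1 < 1 / a - 1 := by
    have : 2 < 1 / a := by rw [lt_div_iff₀ ha]; linarith
    linarith
  refine ⟨_, tsum_ofReal_rpow_ne_top h1, fun y hy => ?_⟩
  refine (pairCount_le ha (by linarith)).trans ?_
  rw [mul_comm]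
  gcongr
  exact powSum_le_tsum _ _

lemma pairCount_half_le {y : ℝ} (hy : 1 ≤ y) :
    pairCount (1 / 2) y ≤
      ENNReal.ofReal 2 * ENNReal.ofReal (logPlus y) * ENNReal.ofReal (y ^ (2 : ℝ)) := by
  refine (pairCount_le (by norm_num) (by linarith)).trans ?_
  have e : (1 : ℝ) / (1 / 2) = 2 := by norm_num
  have e2 : (2 : ℝ) - 1 = 1 := by norm_num
  rw [e, e2, mul_comm]
  gcongr
  exact powSum_one_le_logPlus hy

lemma pairCount_le_of_half_lt {a : ℝ} (h : 1 / 2 < a) (ha1 : a ≤ 1) :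
    ∃ C : ℝ≥0∞, C ≠ ∞ ∧ ∀ y, 1 ≤ y → pairCount a y ≤ C * ENNReal.ofReal (y ^ (2 : ℝ)) := by
  have ha : 0 < a := by linarith
  have h1 : 1 / a < 2 := by rw [div_lt_iff₀ ha]; linarith
  have h2 : 1 ≤ 1 / a := by rw [le_div_iff₀ ha]; linarith
  refine ⟨ENNReal.ofReal (1 / (2 - 1 / a)), ENNReal.ofReal_ne_top, fun y hy => ?_⟩
  have hy0 : 0 < y := by linarith
  refine (pairCount_le ha hy0.le).trans ?_
  calc _ ≤ ENNReal.ofReal (y ^ (1 / a)) *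
      ENNReal.ofReal (y ^ (1 - (1 / a - 1)) / (1 - (1 / a - 1))) := by
        gcongr
        exact powSum_le_rpow (by linarith) (by linarith) hy0.le
    _ = _ := by
        rw [← ENNReal.ofReal_mul (by positivity), ← ENNReal.ofReal_mul
          (div_nonneg (by norm_num) (by linarith))]
        congr 1
        have : y ^ (2 : ℝ) = y ^ (1 / a) * y ^ (1 - (1 / a - 1)) := by
          rw [← Real.rpow_add hy0]; ring_nf
        rw [this]
        ring

/-- `weightCount a b` grows at most like `x^p (log⁺ x)^k`. -/
def CountUpper (a b p : ℝ) (k : ℕ) : Prop :=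
  ∃ C : ℝ≥0∞, C ≠ ∞ ∧ ∀ x, weightCount a b x ≤ C * ENNReal.ofReal (x ^ p * logPlus x ^ k)

lemma countUpper_of_one_le {a b p : ℝ} {k : ℕ} (ha : 0 < a) (ha1 : a ≤ 1) (hb : 0 < b)
    (hb1 : b ≤ 1) {C : ℝ≥0∞} (hC : C ≠ ∞)
    (h : ∀ x, 1 ≤ x → weightCount a b x
      ≤ C * (ENNReal.ofReal (x ^ p) * ENNReal.ofReal (logPlus x) ^ k)) :
    CountUpper a b p k := by
  refine ⟨C, hC, fun x => ?_⟩
  rcases le_or_gt 1 x with hx | hx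
  · refine (h x hx).trans_eq ?_
    have : 0 ≤ logPlus x := zero_le_one.trans (one_le_logPlus x)
    rw [ENNReal.ofReal_mul (by positivity), ENNReal.ofReal_pow this]
  · rw [weightCount_eq_zero ha ha1 hb hb1 hx.le]; exact zero_le

lemma countUpper_lt_half {a b : ℝ} (ha : 0 < a) (h : a < 1 / 2) (hab : a < b) (hb1 : b ≤ 1) :
    CountUpper a b (1 / a) 0 := by
  obtain ⟨C, hC, hCy⟩ := pairCount_le_of_lt_half ha h
  have h1 : 2 < 1 / a := by rw [lt_div_iff₀ ha]; linarith
  have h2 : 1 < b * (1 / a) := by rw [mul_one_div, lt_div_iff₀ ha]; linarith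
  have hb : 0 < b := ha.trans hab
  refine countUpper_of_one_le ha (by linarith) hb hb1
    (ENNReal.mul_ne_top hC (triSum_rpow_ne_top h1 h2)) fun x hx => ?_
  refine (weightCount_le_of_pairCount_le ha (by linarith) hb hb1 (by linarith) C
    fun y hy _ => hCy y hy).trans ?_
  rw [pow_zero, mul_one, mul_right_comm]
  gcongr
  refine triSum_mono hb hb1 fun t _ => ?_
  split_ifs <;> simp

/-- For equal parameters the exponent of `m + 1` in `t^(-1/a)` is exactly 1, whence the logarithm;
the sum over `i` still converges. -/
lemma countUpper_eq_lt_half {a : ℝ} (ha : 0 < a) (h : a < 1 / 2) :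
    CountUpper a a (1 / a) 1 := by
  obtain ⟨C, hC, hCy⟩ := pairCount_le_of_lt_half ha h
  have h1 : 2 < 1 / a := by rw [lt_div_iff₀ ha]; linarith
  have h2 : 1 < (1 - a) * (1 / a) := by rw [mul_one_div, lt_div_iff₀ ha]; linarith
  refine countUpper_of_one_le ha (by linarith) ha (by linarith)
    (ENNReal.mul_ne_top hC (ENNReal.mul_ne_top (tsum_ofReal_rpow_ne_top h2)
      (ENNReal.ofReal_ne_top (r := 1 + 1 / a)))) fun x hx => ?_
  refine (weightCount_le_of_pairCount_le ha (by linarith) ha (by linarith) (by linarith) C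
    fun y hy _ => hCy y hy).trans ?_
  have h4 : powSum (a * (1 / a)) (x ^ (1 / a))
      ≤ ENNReal.ofReal (1 + 1 / a) * ENNReal.ofReal (logPlus x) := by
    rw [mul_one_div_cancel ha.ne']; exact powSum_one_rpow_le hx (by positivity)
  have h3 := (triSum_rpow_le_mul ha (by linarith) (1 / a) x).trans
    (mul_le_mul' h4 (powSum_le_tsum _ _))
  refine (mul_le_mul_right h3 _).trans_eq ?_
  ring

lemma triSum_half_le {x : ℝ} (hx : 1 ≤ x) :
    (triSum (1 / 2) fun t => if t < x then ENNReal.ofReal (t ^ (-(2 : ℝ))) else 0)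
      ≤ ENNReal.ofReal 6 * ENNReal.ofReal (logPlus x) ^ 2 := by
  refine (triSum_rpow_le_mul (by norm_num) (by norm_num) 2 x).trans ?_
  have e : (1 : ℝ) / (1 / 2) = 2 := by norm_num
  have e1 : (1 : ℝ) / 2 * 2 = 1 := by norm_num
  have e2 : (1 - (1 : ℝ) / 2) * 2 = 1 := by norm_num
  rw [e, e1, e2]
  refine (mul_le_mul' (powSum_one_rpow_le hx zero_le_two) (powSum_one_le_logPlus hx)).trans_eq ?_
  have e3 : ENNReal.ofReal 6 = ENNReal.ofReal (1 + 2) * ENNReal.ofReal 2 := by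
    rw [← ENNReal.ofReal_mul (by norm_num)]; norm_num
  rw [e3]; ring

/-- One logarithm comes from the pair count and two from `triSum_half_le`, where both indices have
exponent 1. -/
lemma countUpper_half_half : CountUpper (1 / 2) (1 / 2) 2 3 := by
  refine countUpper_of_one_le (by norm_num) (by norm_num) (by norm_num) (by norm_num)
    (C := ENNReal.ofReal 2 * ENNReal.ofReal 6)
    (ENNReal.mul_ne_top ENNReal.ofReal_ne_top ENNReal.ofReal_ne_top) fun x hx => ?_
  refine (weightCount_le_of_pairCount_le (p := 2) (by norm_num) (by norm_num) (by norm_num)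
    (by norm_num) (by linarith) (ENNReal.ofReal 2 * ENNReal.ofReal (logPlus x))
    fun y hy hyx => ?_).trans ?_
  · refine (pairCount_half_le hy).trans ?_
    gcongr
    exact max_le_max_right _ (Real.log_le_log (by linarith) hyx)
  · refine (mul_le_mul_right (triSum_half_le hx) _).trans_eq ?_
    ring

/-- The `b`-pair is counted first, since it brings no logarithm; the pair with parameter `1/2` then
brings two. -/
lemma countUpper_half_lt {b : ℝ} (hb : 1 / 2 < b) (hb1 : b ≤ 1) : CountUpper (1 / 2) b 2 2 := by
  obtain ⟨C, hC, hCy⟩ := pairCount_le_of_half_lt hb hb1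
  refine countUpper_of_one_le (by norm_num) (by norm_num) (by linarith) hb1
    (ENNReal.mul_ne_top hC (ENNReal.ofReal_ne_top (r := 6))) fun x hx => ?_
  rw [weightCount_comm]
  refine (weightCount_le_of_pairCount_le (by linarith) hb1 (by norm_num)
    (by norm_num) (by linarith) C fun y hy _ => hCy y hy).trans ?_
  refine (mul_le_mul_right (triSum_half_le hx) _).trans_eq ?_
  ring

lemma countUpper_gt_half {a b : ℝ} (ha : 1 / 2 < a) (ha1 : a ≤ 1) (hb : 1 / 2 < b)
    (hb1 : b ≤ 1) : CountUpper a b 2 1 := by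
  obtain ⟨C, hC, hCy⟩ := pairCount_le_of_half_lt ha ha1
  have hb0 : 0 < b := by linarith
  refine countUpper_of_one_le (by linarith) ha1 hb0 hb1
    (ENNReal.mul_ne_top hC (ENNReal.mul_ne_top (ENNReal.ofReal_ne_top (r := 2 / (2 * b - 1)))
      (ENNReal.ofReal_ne_top (r := 1 + 1 / b)))) fun x hx => ?_
  refine (weightCount_le_of_pairCount_le (by linarith) ha1 hb0 hb1 (by linarith) C
    fun y hy _ => hCy y hy).trans ?_
  refine (mul_le_mul_right ((triSum_rpow_two_le hb hb1 x).trans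
    (mul_le_mul_right (powSum_one_rpow_le hx (by positivity)) _)) _).trans_eq ?_
  ring

/-! ### Matching lower bounds for the counts. -/

lemma tsum_zero_le_triSum (a : ℝ) (f : ℝ → ℝ≥0∞) :
    ∑' m : ℕ, f (((m : ℝ) + 1) ^ a) ≤ triSum a f := by
  refine ENNReal.tsum_le_tsum fun m => ?_
  refine le_trans ?_ (ENNReal.le_tsum 0)
  simp [invWeight]

/-- All `m + 1` reciprocal weights of row `m` are at most `m + 1`. This loses little when many `i`
matter, whereas keeping only `i = 0` suits small `a`. -/
lemma tsum_mul_le_triSum {a : ℝ} (ha1 : a ≤ 1) {f : ℝ → ℝ≥0∞} (hf : Antitone f) :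
    ∑' m : ℕ, ENNReal.ofReal ((m : ℝ) + 1) * f ((m : ℝ) + 1) ≤ triSum a f := by
  refine ENNReal.tsum_le_tsum fun m => ?_
  calc ENNReal.ofReal ((m : ℝ) + 1) * f ((m : ℝ) + 1)
      = ∑ i ∈ Finset.range (m + 1), f ((m : ℝ) + 1) := by
        rw [Finset.sum_const, Finset.card_range, nsmul_eq_mul, ← ENNReal.ofReal_natCast]
        norm_num
    _ ≤ ∑ i ∈ Finset.range (m + 1), if i ≤ m then f (invWeight a m i) else 0 := by
        refine Finset.sum_le_sum fun i hi => ?_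
        have h : i ≤ m := Nat.lt_succ_iff.1 (Finset.mem_range.1 hi)
        rw [if_pos h]
        exact hf (invWeight_le ha1 h)
    _ ≤ _ := ENNReal.sum_le_tsum _

lemma antitone_indicator_mul_lt {s : ℝ} (hs : 0 ≤ s) (x : ℝ) :
    Antitone fun t : ℝ => if s * t < x then (1 : ℝ≥0∞) else 0 := by
  intro t u htu
  have : s * t ≤ s * u := by gcongr
  beta_reduce
  split_ifs with h1 h2
  · exact le_rfl
  · exact absurd (this.trans_lt h1) h2
  · exact zero_le
  · exact le_rfl

lemma le_triSum_indicator_mul_lt {b : ℝ} (hb1 : b ≤ 1) {s x : ℝ} (hs : 0 < s) :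
    (if s < x then ENNReal.ofReal ((x / s) ^ 2 / 4) else 0)
      ≤ triSum b fun t => if s * t < x then (1 : ℝ≥0∞) else 0 := by
  split_ifs with h
  · refine (ofReal_sq_le_powSum_neg_one ((one_lt_div hs).2 h)).trans ?_
    refine le_trans ?_ (tsum_mul_le_triSum hb1 (antitone_indicator_mul_lt hs.le x))
    refine ENNReal.tsum_le_tsum fun n => ?_
    simp only [lt_div_iff₀ hs, neg_neg, Real.rpow_one, mul_comm s, mul_ite, mul_one, mul_zero]
    exact le_rfl
  · exact zero_le

/-- The two triangles `i ≤ m` and `m ≤ i` cover the square and have equal sums. -/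
lemma sq_tsum_le_two_mul (f : ℕ → ℝ≥0∞) :
    (∑' m, f m) ^ 2 ≤ 2 * ∑' m, ∑' i, if i ≤ m then f m * f i else 0 := by
  calc (∑' m, f m) ^ 2 = ∑' m, ∑' i, f m * f i := by
        simp_rw [ENNReal.tsum_mul_left, ENNReal.tsum_mul_right, sq]
    _ ≤ ∑' m, ∑' i, ((if i ≤ m then f m * f i else 0) + (if m ≤ i then f m * f i else 0)) := by
        refine ENNReal.tsum_le_tsum fun m => ENNReal.tsum_le_tsum fun i => ?_
        rcases le_total i m with h | h
        · rw [if_pos h]; exact le_self_add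
        · rw [if_pos h]; exact le_add_self
    _ = _ := by
        simp_rw [ENNReal.tsum_add]
        rw [two_mul]
        congr 1
        rw [ENNReal.tsum_comm]
        exact tsum_congr fun m => tsum_congr fun i => by rw [mul_comm]

/-- `weightCount a b` grows at least like `x^p (log⁺ x)^k`. -/
def CountLower (a b p : ℝ) (k : ℕ) : Prop :=
  ∃ c x₀ : ℝ, 0 < c ∧ ∀ x, x₀ ≤ x →
    ENNReal.ofReal (c * (x ^ p * logPlus x ^ k)) ≤ weightCount a b x

lemma countLower_of_log {a b p : ℝ} {k : ℕ} (c x₀ : ℝ) (hc : 0 < c)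
    (h : ∀ x, x₀ ≤ x → 2 ≤ x → ENNReal.ofReal (c * x ^ p) * ENNReal.ofReal (Real.log x) ^ k
      ≤ weightCount a b x) : CountLower a b p k := by
  refine ⟨c, max x₀ (max 2 (Real.exp 1)), hc, fun x hx => ?_⟩
  have h1 : x₀ ≤ x := (le_max_left _ _).trans hx
  have h2 : max 2 (Real.exp 1) ≤ x := (le_max_right _ _).trans hx
  have h3 : 2 ≤ x := (le_max_left _ _).trans h2
  have h4 : Real.exp 1 ≤ x := (le_max_right _ _).trans h2
  refine le_of_eq_of_le ?_ (h x h1 h3)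
  have h5 : 1 ≤ Real.log x := (Real.le_log_iff_exp_le (by linarith)).2 h4
  have h6 : logPlus x = Real.log x := max_eq_left h5
  rw [h6, ← mul_assoc, ENNReal.ofReal_mul (mul_nonneg hc.le (by positivity)),
    ENNReal.ofReal_pow (by linarith)]

lemma lt_rpow_iff {a x m : ℝ} (ha : 0 < a) (hx : 0 ≤ x) (hm : 0 ≤ m) :
    m < x ^ (1 / a) ↔ m ^ a < x := by
  rw [← Real.rpow_lt_rpow_iff hm (by positivity) ha, ← Real.rpow_mul hx,
    one_div_mul_cancel ha.ne', Real.rpow_one]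

lemma countLower_zero {a b : ℝ} (ha : 0 < a) : CountLower a b (1 / a) 0 := by
  refine countLower_of_log (1 / 2) 0 (by norm_num) fun x _ hx => ?_
  have hx0 : 0 ≤ x := by linarith
  calc _ = ENNReal.ofReal (x ^ (1 / a) / 2) := by rw [pow_zero, mul_one]; ring_nf
    _ ≤ powSum 0 (x ^ (1 / a)) :=
        ofReal_half_le_powSum_zero (Real.one_lt_rpow (by linarith) (by positivity))
    _ ≤ triSum a (fun s => if s < x then 1 else 0) := by
        refine le_trans ?_ (tsum_zero_le_triSum _ _)
        refine ENNReal.tsum_le_tsum fun m => ?_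
        simp only [lt_rpow_iff ha hx0 (by positivity : (0 : ℝ) ≤ (m : ℝ) + 1)]
        simp
    _ ≤ _ := by
        refine ENNReal.tsum_le_tsum fun m => ENNReal.tsum_le_tsum fun i => ?_
        split_ifs with h1
        · refine le_trans ?_ (tsum_zero_le_triSum _ _)
          refine le_trans ?_ (ENNReal.le_tsum 0)
          simp
        · exact le_rfl

/-- With `i = j = 0` the count is that of the pairs with `(m+1)(n+1) < z`, a divisor sum of order `z
log z`. -/
lemma countLower_eq_lt_half {a : ℝ} (ha : 0 < a) : CountLower a a (1 / a) 1 := by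
  refine countLower_of_log (1 / (2 * a)) 0 (by positivity) fun x _ hx => ?_
  have hx0 : 0 < x := by linarith
  set z := x ^ (1 / a) with hz
  have hz0 : 0 < z := by positivity
  calc _ = ENNReal.ofReal (z / 2) * ENNReal.ofReal (Real.log z) := by
        have hl : 0 ≤ Real.log x := Real.log_nonneg (by linarith)
        rw [pow_one, ← ENNReal.ofReal_mul (by positivity), ← ENNReal.ofReal_mul (by positivity),
          hz, Real.log_rpow hx0]
        congr 1; field_simp
    _ ≤ ENNReal.ofReal (z / 2) * powSum 1 z := by
        gcongr; exact ofReal_log_le_powSum_one hz0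
    _ = ∑' m : ℕ, ENNReal.ofReal (z / 2) *
          (if (m : ℝ) + 1 < z then ENNReal.ofReal (((m : ℝ) + 1) ^ (-(1 : ℝ))) else 0) := by
        rw [ENNReal.tsum_mul_left, powSum]
    _ ≤ ∑' m : ℕ, triSum a fun t => if ((m : ℝ) + 1) ^ a * t < x then (1 : ℝ≥0∞) else 0 := by
        refine ENNReal.tsum_le_tsum fun m => ?_
        have hm : (0 : ℝ) < (m : ℝ) + 1 := by positivity
        split_ifs with h
        · refine le_trans ?_ ((ofReal_half_le_powSum_zero ((one_lt_div hm).2 h)).trans ?_)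
          · rw [← ENNReal.ofReal_mul (by positivity), Real.rpow_neg_one]
            refine le_of_eq ?_
            congr 1; field_simp
          · refine le_trans ?_ (tsum_zero_le_triSum _ _)
            refine ENNReal.tsum_le_tsum fun n => ?_
            have hn : (0 : ℝ) < (n : ℝ) + 1 := by positivity
            rw [neg_zero, Real.rpow_zero, ENNReal.ofReal_one]
            simp only [lt_div_iff₀ hm, ← Real.mul_rpow hm.le hn.le]
            rw [mul_comm ((m : ℝ) + 1)]
            simp only [hz, lt_rpow_iff ha hx0.le (mul_pos hn hm).le]
            exact le_rfl
        · rw [mul_zero]; exact zero_le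
    _ ≤ _ := tsum_zero_le_triSum a
        (fun s => triSum a fun t => if s * t < x then (1 : ℝ≥0∞) else 0)

/-- Bounding both reciprocal weights by `m + 1` and `n + 1` leaves `∑ (m+1) (x/(m+1))² / 4`, a
harmonic sum times `x² / 4`. -/
lemma countLower_two_one {a b : ℝ} (ha1 : a ≤ 1) (hb : 0 < b) (hb1 : b ≤ 1) :
    CountLower a b 2 1 := by
  refine countLower_of_log (1 / 4) 0 (by norm_num) fun x _ hx => ?_
  have hx0 : 0 < x := by linarith
  have hanti : Antitone fun s : ℝ => triSum b fun t => if t * s < x then (1 : ℝ≥0∞) else 0 := by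
    intro s u hsu
    exact triSum_mono hb hb1 fun t ht =>
      antitone_indicator_mul_lt (by linarith : (0 : ℝ) ≤ t) x hsu
  calc _ ≤ ENNReal.ofReal (1 / 4 * x ^ (2 : ℝ)) * powSum 1 x := by
        rw [pow_one]; gcongr; exact ofReal_log_le_powSum_one hx0
    _ = ∑' m : ℕ, ENNReal.ofReal (1 / 4 * x ^ (2 : ℝ)) *
          (if (m : ℝ) + 1 < x then ENNReal.ofReal (((m : ℝ) + 1) ^ (-(1 : ℝ))) else 0) := by
        rw [ENNReal.tsum_mul_left, powSum]
    _ ≤ ∑' m : ℕ, ENNReal.ofReal ((m : ℝ) + 1) *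
          triSum b fun t => if t * ((m : ℝ) + 1) < x then (1 : ℝ≥0∞) else 0 := by
        refine ENNReal.tsum_le_tsum fun m => ?_
        have hm : (0 : ℝ) < (m : ℝ) + 1 := by positivity
        have h := le_triSum_indicator_mul_lt hb1 (x := x) hm
        simp only [mul_comm ((m : ℝ) + 1)] at h
        refine le_trans ?_ (mul_le_mul_right h _)
        split_ifs with h
        · rw [← ENNReal.ofReal_mul (by positivity), ← ENNReal.ofReal_mul (by positivity),
            Real.rpow_neg_one, Real.rpow_two]
          refine le_of_eq ?_
          congr 1; field_simp
        · rw [mul_zero]; exact zero_le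
    _ ≤ _ := by
        refine (tsum_mul_le_triSum ha1 hanti).trans_eq ?_
        simp only [weightCount, mul_comm]

lemma invWeight_half (m i : ℕ) :
    invWeight (1 / 2) m i ^ 2 = ((m : ℝ) + 1) * ((i : ℝ) + 1) := by
  have e : (1 : ℝ) - 1 / 2 = 1 / 2 := by norm_num
  unfold invWeight
  rw [e, mul_pow, ← Real.sqrt_eq_rpow, ← Real.sqrt_eq_rpow, Real.sq_sqrt (by positivity),
    Real.sq_sqrt (by positivity)]

lemma countLower_half_lt {b : ℝ} (hb1 : b ≤ 1) : CountLower (1 / 2) b 2 2 := by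
  refine countLower_of_log (1 / 8) 0 (by norm_num) fun x _ hx => ?_
  have hx0 : 0 < x := by linarith
  set f : ℕ → ℝ≥0∞ := fun m =>
    if (m : ℝ) + 1 < x then ENNReal.ofReal (((m : ℝ) + 1) ^ (-(1 : ℝ))) else 0 with hf
  have e : ENNReal.ofReal (1 / 8 * x ^ (2 : ℝ)) * 2 = ENNReal.ofReal (x ^ 2 / 4) := by
    rw [← ENNReal.ofReal_ofNat 2, ← ENNReal.ofReal_mul (by positivity), Real.rpow_two]
    congr 1; ring
  calc _ ≤ ENNReal.ofReal (1 / 8 * x ^ (2 : ℝ)) * (powSum 1 x) ^ 2 := by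
        gcongr; exact ofReal_log_le_powSum_one hx0
    _ ≤ ENNReal.ofReal (1 / 8 * x ^ (2 : ℝ)) *
          (2 * ∑' m, ∑' i, if i ≤ m then f m * f i else 0) := by
        gcongr; exact sq_tsum_le_two_mul f
    _ = ∑' m, ∑' i, ENNReal.ofReal (x ^ 2 / 4) * if i ≤ m then f m * f i else 0 := by
        rw [← mul_assoc, e]; simp_rw [ENNReal.tsum_mul_left]
    _ ≤ _ := by
        refine ENNReal.tsum_le_tsum fun m => ENNReal.tsum_le_tsum fun i => ?_
        by_cases h : i ≤ m
        · rw [if_pos h, if_pos h]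
          refine le_trans ?_ (le_triSum_indicator_mul_lt hb1 (invWeight_pos _ m i))
          simp only [hf]
          split_ifs with h1 h2 h3
          · rw [← ENNReal.ofReal_mul (by positivity), ← ENNReal.ofReal_mul (by positivity),
              div_pow, invWeight_half, Real.rpow_neg_one, Real.rpow_neg_one]
            refine le_of_eq ?_
            congr 1; field_simp
          · exact absurd ((invWeight_le (by norm_num) h).trans_lt h1) h3
          all_goals simp
        · rw [if_neg h, if_neg h, mul_zero]

lemma ofReal_half_le_tsum_ge {z : ℝ} {j : ℕ} (h : 2 * ((j : ℝ) + 1) ≤ z) :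
    ENNReal.ofReal (z / 2) ≤ ∑' n : ℕ, if j ≤ n then (if (n : ℝ) + 1 < z then 1 else 0) else 0 := by
  calc ENNReal.ofReal (z / 2) ≤ ENNReal.ofReal (z - j - 1) :=
        ENNReal.ofReal_le_ofReal (by linarith)
    _ ≤ powSum 0 (z - j) := ofReal_sub_one_le_powSum_zero _
    _ = ∑' n : ℕ, if j ≤ j + n then (if ((j + n : ℕ) : ℝ) + 1 < z then (1 : ℝ≥0∞) else 0)
          else 0 := by
        refine tsum_congr fun n => ?_
        have : (n : ℝ) + 1 < z - j ↔ ((j + n : ℕ) : ℝ) + 1 < z := by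
          push_cast; constructor <;> intro <;> linarith
        simp [this]
    _ ≤ _ := ENNReal.tsum_comp_le_tsum_of_injective (add_right_injective j)
        (fun n : ℕ => if j ≤ n then (if (n : ℝ) + 1 < z then (1 : ℝ≥0∞) else 0) else 0)

lemma countLower_half_half : CountLower (1 / 2) (1 / 2) 2 3 := by
  refine countLower_of_log (1 / 256) 0 (by norm_num) fun x _ hx => ?_
  have hx0 : 0 < x := by linarith
  -- The condition is `(m+1)(i+1)(j+1)(n+1) < x²`. Keeping `m+1, i+1, j+1` below `K` leaves `n` a
  -- range up to `z ≥ 2(j+1)`, so `j ≤ n` costs only a factor 2. The constant is `256 = 4³ · 2 · 2`: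
  -- `log x = 4 log K` cubed, the symmetrization in `m, i`, and this factor.
  set K := x ^ (1 / 4 : ℝ) with hK
  have hK0 : 0 < K := by positivity
  have hK4 : K ^ 4 = x := by
    rw [hK, ← Real.rpow_natCast, ← Real.rpow_mul hx0.le]; norm_num
  have hlog : Real.log x = 4 * Real.log K := by rw [← hK4, Real.log_pow]; norm_num
  set f : ℕ → ℝ≥0∞ := fun m =>
    if (m : ℝ) + 1 < K then ENNReal.ofReal (((m : ℝ) + 1) ^ (-(1 : ℝ))) else 0 with hf
  have hfK : ∑' m, f m = powSum 1 K := rfl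
  have key : ∀ m i j : ℕ, i ≤ m →
      ENNReal.ofReal (x ^ 2 / 2) * (f m * f i) * f j
        ≤ ∑' n : ℕ, if j ≤ n then
          (if invWeight (1 / 2) m i * invWeight (1 / 2) n j < x then 1 else 0) else 0 := by
    intro m i j him
    simp only [hf]
    split_ifs with h1 h2 h3
    · set z := x ^ 2 / (((m : ℝ) + 1) * ((i : ℝ) + 1) * ((j : ℝ) + 1)) with hz
      have hz2 : 2 * ((j : ℝ) + 1) ≤ z := by
        rw [hz, le_div_iff₀ (by positivity)]
        calc 2 * ((j : ℝ) + 1) * (((m : ℝ) + 1) * ((i : ℝ) + 1) * ((j : ℝ) + 1))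
            ≤ 2 * K * (K * K * K) := by gcongr
          _ = 2 * x := by rw [← hK4]; ring
          _ ≤ x ^ 2 := by nlinarith
      refine le_trans (le_of_eq ?_) ((ofReal_half_le_tsum_ge hz2).trans (le_of_eq ?_))
      · rw [← ENNReal.ofReal_mul (by positivity), ← ENNReal.ofReal_mul (by positivity),
          ← ENNReal.ofReal_mul (by positivity)]
        simp only [Real.rpow_neg_one, hz]
        congr 1; field_simp
      · refine tsum_congr fun n => ?_
        have : (n : ℝ) + 1 < z ↔ invWeight (1 / 2) m i * invWeight (1 / 2) n j < x := by
          rw [hz, lt_div_iff₀ (by positivity), ← pow_lt_pow_iff_left₀ (n := 2)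
            (mul_pos (invWeight_pos _ _ _) (invWeight_pos _ _ _)).le hx0.le two_ne_zero,
            mul_pow, invWeight_half, invWeight_half]
          ring_nf
        simp only [this]
    all_goals simp
  have e : ENNReal.ofReal (1 / 256 * x ^ (2 : ℝ)) * ENNReal.ofReal 4 ^ 3 * 2
      = ENNReal.ofReal (x ^ 2 / 2) := by
    rw [← ENNReal.ofReal_ofNat 2, ← ENNReal.ofReal_pow (by norm_num),
      ← ENNReal.ofReal_mul (by positivity), ← ENNReal.ofReal_mul (by positivity), Real.rpow_two]
    congr 1; ring
  calc _ ≤ ENNReal.ofReal (1 / 256 * x ^ (2 : ℝ)) * (ENNReal.ofReal 4 * powSum 1 K) ^ 3 := by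
        rw [hlog, ENNReal.ofReal_mul (by norm_num : (0 : ℝ) ≤ 4)]
        gcongr; exact ofReal_log_le_powSum_one hK0
    _ = ENNReal.ofReal (1 / 256 * x ^ (2 : ℝ)) * ENNReal.ofReal 4 ^ 3 *
          (powSum 1 K) ^ 2 * powSum 1 K := by ring
    _ ≤ ENNReal.ofReal (1 / 256 * x ^ (2 : ℝ)) * ENNReal.ofReal 4 ^ 3 *
          (2 * ∑' m, ∑' i, if i ≤ m then f m * f i else 0) * powSum 1 K := by
        gcongr; exact sq_tsum_le_two_mul f
    _ = ∑' m, ∑' i, ENNReal.ofReal (x ^ 2 / 2) * (if i ≤ m then f m * f i else 0) *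
          powSum 1 K := by
        rw [← mul_assoc, e]; simp_rw [ENNReal.tsum_mul_right, ENNReal.tsum_mul_left]
    _ ≤ _ := by
        refine ENNReal.tsum_le_tsum fun m => ENNReal.tsum_le_tsum fun i => ?_
        by_cases h : i ≤ m
        · rw [if_pos h, if_pos h, ← hfK, ← ENNReal.tsum_mul_left]
          beta_reduce
          rw [triSum, ENNReal.tsum_comm]
          exact ENNReal.tsum_le_tsum fun j => key m i j h
        · rw [if_neg h, if_neg h, mul_zero, zero_mul]

/-! ### Size of the Cesàro numbers and of the normalized weights. -/

lemma cesaroA_zero (a : ℝ) : cesaroA a 0 = 1 := by simp [cesaroA]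

lemma cesaroA_succ (a : ℝ) (n : ℕ) :
    cesaroA a (n + 1) = cesaroA a n * (1 + a / ((n : ℝ) + 1)) := by
  have h : (n.factorial : ℝ) ≠ 0 := by exact_mod_cast n.factorial_ne_zero
  have h' : (n : ℝ) + 1 ≠ 0 := by positivity
  unfold cesaroA
  rw [Finset.prod_range_succ, Nat.factorial_succ]
  push_cast
  field_simp
  ring

lemma cesaroA_pos {a : ℝ} (ha : 0 ≤ a) (n : ℕ) : 0 < cesaroA a n := by
  induction n with
  | zero => simp [cesaroA_zero]
  | succ n ih => rw [cesaroA_succ]; positivity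

lemma cesaroA_sub_one {a : ℝ} (ha : 0 < a) (n : ℕ) :
    cesaroA (a - 1) n = cesaroA a n * (a / (a + n)) := by
  induction n with
  | zero => simp [cesaroA_zero, ha.ne']
  | succ n ih =>
    rw [cesaroA_succ, cesaroA_succ, ih]
    have h1 : (n : ℝ) + 1 ≠ 0 := by positivity
    have h2 : a + (n : ℝ) ≠ 0 := by positivity
    have h3 : a + ((n : ℝ) + 1) ≠ 0 := by positivity
    push_cast
    field_simp
    ring

lemma cesaroA_sub_one_pos {a : ℝ} (ha : 0 < a) (n : ℕ) : 0 < cesaroA (a - 1) n := by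
  have := cesaroA_pos ha.le n
  rw [cesaroA_sub_one ha]
  positivity

lemma rpow_le_cesaroA {a : ℝ} (ha : 0 ≤ a) (ha1 : a ≤ 1) (n : ℕ) :
    ((n : ℝ) + 1) ^ a ≤ cesaroA a n := by
  induction n with
  | zero => simp [cesaroA_zero]
  | succ n ih =>
    have hn : (0 : ℝ) < (n : ℝ) + 1 := by positivity
    have hb : (1 + 1 / ((n : ℝ) + 1)) ^ a ≤ 1 + a * (1 / ((n : ℝ) + 1)) :=
      rpow_one_add_le_one_add_mul_self (by linarith [show 0 ≤ 1 / ((n : ℝ) + 1) by positivity])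
        ha ha1
    have e : ((n + 1 : ℕ) : ℝ) + 1 = ((n : ℝ) + 1) * (1 + 1 / ((n : ℝ) + 1)) := by
      push_cast; field_simp
    rw [e, Real.mul_rpow hn.le (by positivity), cesaroA_succ]
    rw [mul_one_div] at hb
    gcongr
    exact (cesaroA_pos ha n).le

/-- Each factor satisfies `1 + u ≤ exp u`, and the harmonic number is at most `1 + log (n+1)`. -/
lemma cesaroA_le {a : ℝ} (ha : 0 ≤ a) (ha1 : a ≤ 1) (n : ℕ) :
    cesaroA a n ≤ Real.exp 1 * ((n : ℝ) + 1) ^ a := by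
  have h : cesaroA a n ≤ Real.exp (a * (harmonic n : ℝ)) := by
    induction n with
    | zero => simp [cesaroA_zero]
    | succ n ih =>
      rw [cesaroA_succ, harmonic_succ]
      push_cast
      rw [mul_add a, Real.exp_add]
      have : 1 + a / ((n : ℝ) + 1) ≤ Real.exp (a * ((n : ℝ) + 1)⁻¹) := by
        rw [add_comm, div_eq_mul_inv]; exact Real.add_one_le_exp _
      have := cesaroA_pos ha n
      gcongr
  have hn : (0 : ℝ) < (n : ℝ) + 1 := by positivity
  have h2 : (harmonic n : ℝ) ≤ 1 + Real.log ((n : ℝ) + 1) := by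
    refine (harmonic_le_one_add_log n).trans ?_
    rcases Nat.eq_zero_or_pos n with h0 | h0
    · simp [h0]
    · have : (0 : ℝ) < n := by exact_mod_cast h0
      gcongr
      linarith
  calc _ ≤ _ := h
    _ ≤ Real.exp (a * (1 + Real.log ((n : ℝ) + 1))) := by gcongr
    _ = Real.exp a * ((n : ℝ) + 1) ^ a := by
        rw [Real.rpow_def_of_pos hn, ← Real.exp_add]; ring_nf
    _ ≤ _ := by gcongr

lemma sum_cesaroA_sub_one (a : ℝ) (m : ℕ) :
    ∑ k ∈ Finset.range (m + 1), cesaroA (a - 1) (m - k) = cesaroA a m := by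
  have h := Finset.sum_range_reflect (fun i => cesaroA (a - 1) i) (m + 1)
  simp only [Nat.add_sub_cancel] at h
  rw [h]
  clear h
  induction m with
  | zero => simp [cesaroA_zero]
  | succ m ih =>
    rw [Finset.sum_range_succ, ih]
    -- This is the increment `A_{n+1}^a - A_n^a`, so the sum telescopes.
    have h0 : ∀ n, cesaroA (a - 1) (n + 1) = cesaroA a n * (a / ((n : ℝ) + 1)) := by
      intro n
      have h : (n.factorial : ℝ) ≠ 0 := by exact_mod_cast n.factorial_ne_zero
      have h' : (n : ℝ) + 1 ≠ 0 := by positivity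
      unfold cesaroA
      rw [Finset.prod_range_succ', Nat.factorial_succ]
      have e : ∀ k : ℕ, a - 1 + (((k + 1 : ℕ) : ℝ) + 1) = a + ((k : ℝ) + 1) := by
        intro k; push_cast; ring
      simp only [e]
      push_cast
      field_simp
      ring
    rw [h0, cesaroA_succ]
    ring

/-- The normalized weight `A_i^{a-1} / A_m^a`. -/
noncomputable def cesaroRatio (a : ℝ) (m i : ℕ) : ℝ := cesaroA (a - 1) i / cesaroA a m

lemma cesaroRatio_pos {a : ℝ} (ha : 0 < a) (m i : ℕ) : 0 < cesaroRatio a m i :=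
  div_pos (cesaroA_sub_one_pos ha i) (cesaroA_pos ha.le m)

lemma sum_cesaroRatio {a : ℝ} (ha : 0 < a) (m : ℕ) :
    ∑ k ∈ Finset.range (m + 1), cesaroRatio a m (m - k) = 1 := by
  unfold cesaroRatio
  rw [← Finset.sum_div, sum_cesaroA_sub_one, div_self (cesaroA_pos ha.le m).ne']

lemma cesaroRatio_le {a : ℝ} (ha : 0 < a) (ha1 : a ≤ 1) (m i : ℕ) :
    cesaroRatio a m i ≤ Real.exp 1 / invWeight a m i := by
  have hi : (0 : ℝ) < (i : ℝ) + 1 := by positivity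
  unfold cesaroRatio
  rw [div_le_div_iff₀ (cesaroA_pos ha.le m) (invWeight_pos a m i), cesaroA_sub_one ha]
  have h1 : a / (a + i) ≤ 1 / ((i : ℝ) + 1) := by
    rw [div_le_div_iff₀ (by positivity) hi]
    nlinarith [(Nat.cast_nonneg i : (0 : ℝ) ≤ i)]
  have e : ((i : ℝ) + 1) ^ a * (((i : ℝ) + 1) ^ (1 - a)) = (i : ℝ) + 1 := by
    rw [← Real.rpow_add hi]; simp
  calc cesaroA a i * (a / (a + i)) * invWeight a m i
      ≤ (Real.exp 1 * ((i : ℝ) + 1) ^ a) * (1 / ((i : ℝ) + 1)) *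
        (cesaroA a m * ((i : ℝ) + 1) ^ (1 - a)) := by
        unfold invWeight
        have := rpow_le_cesaroA ha.le ha1 m
        have := cesaroA_le ha.le ha1 i
        have := cesaroA_pos ha.le i
        gcongr
    _ = Real.exp 1 * cesaroA a m * (((i : ℝ) + 1) ^ a * (((i : ℝ) + 1) ^ (1 - a)))
          * (1 / ((i : ℝ) + 1)) := by ring
    _ = _ := by rw [e]; field_simp

lemma le_cesaroRatio {a : ℝ} (ha : 0 < a) (ha1 : a ≤ 1) (m i : ℕ) :
    a / Real.exp 1 / invWeight a m i ≤ cesaroRatio a m i := by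
  have hi : (0 : ℝ) < (i : ℝ) + 1 := by positivity
  unfold cesaroRatio
  rw [div_div, div_le_div_iff₀ (mul_pos (Real.exp_pos 1) (invWeight_pos a m i))
    (cesaroA_pos ha.le m), cesaroA_sub_one ha]
  have h1 : a / ((i : ℝ) + 1) ≤ a / (a + i) :=
    div_le_div_of_nonneg_left ha.le (by positivity) (by linarith)
  have e : ((i : ℝ) + 1) ^ a * (((i : ℝ) + 1) ^ (1 - a)) = (i : ℝ) + 1 := by
    rw [← Real.rpow_add hi]; simp
  calc a * cesaroA a m ≤ a * (Real.exp 1 * ((m : ℝ) + 1) ^ a) := by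
        gcongr; exact cesaroA_le ha.le ha1 m
    _ = (((i : ℝ) + 1) ^ a * (((i : ℝ) + 1) ^ (1 - a))) * (a / ((i : ℝ) + 1)) *
          (Real.exp 1 * ((m : ℝ) + 1) ^ a) := by rw [e]; field_simp
    _ = ((i : ℝ) + 1) ^ a * (a / ((i : ℝ) + 1)) * (Real.exp 1 * invWeight a m i) := by
        unfold invWeight; ring
    _ ≤ _ := by
        have := rpow_le_cesaroA ha.le ha1 i
        have := invWeight_pos a m i
        gcongr
        exact (cesaroA_pos ha.le i).le

/-! ### A Chernoff bound for truncated weighted sums. -/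

section Probability

variable {Ω : Type*} [MeasurableSpace Ω] {P : Measure Ω}

/-- The value `c * x`, replaced by `0` when it exceeds `δ` in absolute value. -/
noncomputable def truncMul (δ c x : ℝ) : ℝ := if |c * x| ≤ δ then c * x else 0

lemma measurable_truncMul (δ c : ℝ) : Measurable (truncMul δ c) := by
  unfold truncMul
  exact Measurable.ite (measurableSet_le (by fun_prop) measurable_const) (by fun_prop)
    measurable_const

lemma abs_truncMul_le {δ : ℝ} (hδ : 0 ≤ δ) (c x : ℝ) : |truncMul δ c x| ≤ δ := by
  unfold truncMul
  split_ifs with h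
  · exact h
  · simpa using hδ

lemma exp_le_one_add_add_sq_mul (u : ℝ) : Real.exp u ≤ 1 + u + u ^ 2 * Real.exp |u| := by
  have h := Complex.norm_exp_sub_sum_le_norm_mul_exp (u : ℂ) 2
  simp only [Finset.sum_range_succ, Finset.sum_range_zero, zero_add, pow_zero, pow_one,
    Nat.factorial_zero, Nat.factorial_one, Nat.cast_one, div_one] at h
  rw [← Complex.ofReal_exp, ← Complex.ofReal_one, ← Complex.ofReal_add, ← Complex.ofReal_sub,
    Complex.norm_real, Complex.norm_real, Real.norm_eq_abs, Real.norm_eq_abs, sq_abs] at h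
  linarith [le_abs_self (Real.exp u - (1 + u))]

/-- The linear term is that of the untruncated variable, so no recentring is needed. Where
truncation acts, `|c x| > δ` and `(c x)² / δ` outweighs `c x`; this is the role of `r / δ`. -/
lemma exp_mul_truncMul_le {δ r : ℝ} (hδ : 0 < δ) (hr : 0 ≤ r) (c x : ℝ) :
    Real.exp (r * truncMul δ c x)
      ≤ 1 + r * c * x + (r / δ + r ^ 2 * Real.exp (r * δ)) * c ^ 2 * x ^ 2 := by
  have hA : 0 ≤ r ^ 2 * Real.exp (r * δ) * (c * x) ^ 2 := by positivity
  unfold truncMul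
  split_ifs with h
  · have h1 := exp_le_one_add_add_sq_mul (r * (c * x))
    have h2 : Real.exp |r * (c * x)| ≤ Real.exp (r * δ) := by
      rw [abs_mul, abs_of_nonneg hr]; gcongr
    have h3 : (r * (c * x)) ^ 2 * Real.exp |r * (c * x)|
        ≤ (r * (c * x)) ^ 2 * Real.exp (r * δ) := by gcongr
    have h4 : 0 ≤ r / δ * (c * x) ^ 2 := by positivity
    nlinarith
  · have h1 : δ < |c * x| := not_le.1 h
    have h2 : 0 ≤ c * x + (c * x) ^ 2 / δ := by
      have : |c * x| ≤ (c * x) ^ 2 / δ := by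
        rw [le_div_iff₀ hδ, ← sq_abs]; nlinarith [abs_nonneg (c * x)]
      linarith [neg_abs_le (c * x)]
    have h3 : 0 ≤ r * (c * x + (c * x) ^ 2 / δ) := mul_nonneg hr h2
    have e : r * c * x + (r / δ + r ^ 2 * Real.exp (r * δ)) * c ^ 2 * x ^ 2
      = r * (c * x + (c * x) ^ 2 / δ) + r ^ 2 * Real.exp (r * δ) * (c * x) ^ 2 := by ring
    rw [mul_zero, Real.exp_zero]
    linarith

lemma integral_exp_mul_truncMul_le [IsProbabilityMeasure P] {Y : Ω → ℝ} (hY : Integrable Y P)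
    (hY2 : Integrable (fun ω => Y ω ^ 2) P) {δ r : ℝ} (hδ : 0 < δ) (hr : 0 ≤ r) (c : ℝ) :
    ∫ ω, Real.exp (r * truncMul δ c (Y ω)) ∂P ≤ Real.exp (r * c * (∫ ω, Y ω ∂P) +
      (r / δ + r ^ 2 * Real.exp (r * δ)) * c ^ 2 * ∫ ω, Y ω ^ 2 ∂P) := by
  have i1 : Integrable (fun ω => 1 + r * c * Y ω) P :=
    (integrable_const 1).add (hY.const_mul _)
  have i2 := hY2.const_mul ((r / δ + r ^ 2 * Real.exp (r * δ)) * c ^ 2)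
  calc _ ≤ ∫ ω, (1 + r * c * Y ω +
        (r / δ + r ^ 2 * Real.exp (r * δ)) * c ^ 2 * Y ω ^ 2) ∂P :=
        integral_mono_of_nonneg (ae_of_all _ fun ω => (Real.exp_pos _).le) (i1.add i2)
          (ae_of_all _ fun ω => exp_mul_truncMul_le hδ hr c (Y ω))
    _ = (r * c * (∫ ω, Y ω ∂P) +
          (r / δ + r ^ 2 * Real.exp (r * δ)) * c ^ 2 * ∫ ω, Y ω ^ 2 ∂P) + 1 := by
        rw [integral_add i1 i2, integral_add (integrable_const 1) (hY.const_mul _),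
          integral_const_mul, integral_const_mul]
        simp only [integral_const, probReal_univ, smul_eq_mul]
        ring
    _ ≤ _ := Real.add_one_le_exp _

/-- A truncated Chernoff bound for weighted sums of identically distributed variables. -/
lemma measure_weighted_sum_gt_le [IsProbabilityMeasure P] {ι : Type*} {ξ : ι → Ω → ℝ} {Y : Ω → ℝ}
    (hindep : iIndepFun ξ P) (hid : ∀ i, IdentDistrib (ξ i) Y P P) (s : Finset ι) (w : ι → ℝ)
    (hw : ∑ i ∈ s, w i = 1) (hY : Integrable Y P) (hY2 : Integrable (fun ω => Y ω ^ 2) P)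
    {δ r : ℝ} (hδ : 0 < δ) (hr : 0 ≤ r) (ε : ℝ) :
    P {ω | ε < ∑ i ∈ s, w i * ξ i ω - ∫ ω, Y ω ∂P} ≤ ∑ i ∈ s, P {ω | δ < |w i * Y ω|} +
      ENNReal.ofReal (Real.exp (-r * ε + (r / δ + r ^ 2 * Real.exp (r * δ)) *
        ((∑ i ∈ s, w i ^ 2) * ∫ ω, Y ω ^ 2 ∂P))) := by
  set M := ∫ ω, Y ω ∂P
  set σ := ∫ ω, Y ω ^ 2 ∂P
  set U : ι → Ω → ℝ := fun i ω => truncMul δ (w i) (ξ i ω) with hU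
  have hUid : ∀ i, IdentDistrib (U i) (fun ω => truncMul δ (w i) (Y ω)) P P := fun i =>
    (hid i).comp (measurable_truncMul δ (w i))
  have hUind : iIndepFun U P := hindep.comp _ fun i => measurable_truncMul δ (w i)
  have hsub : {ω | ε < ∑ i ∈ s, w i * ξ i ω - M} ⊆
      (⋃ i ∈ s, {ω | δ < |w i * ξ i ω|}) ∪ {ω | ε + M ≤ (∑ i ∈ s, U i) ω} := by
    intro ω hω
    by_cases h : ∃ i ∈ s, δ < |w i * ξ i ω|
    · left; simpa using h
    · right
      push Not at h
      have : (∑ i ∈ s, U i) ω = ∑ i ∈ s, w i * ξ i ω := by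
        rw [Finset.sum_apply]
        exact Finset.sum_congr rfl fun i hi => if_pos (h i hi)
      simp only [Set.mem_ofPred_eq] at hω ⊢
      rw [this]; linarith
  have hmeas : AEMeasurable (∑ i ∈ s, U i) P :=
    Finset.aemeasurable_sum s fun i _ => (hUid i).aemeasurable_fst
  have hbdd : ∀ ω, |(∑ i ∈ s, U i) ω| ≤ s.card * δ := by
    intro ω
    rw [Finset.sum_apply]
    refine (Finset.abs_sum_le_sum_abs _ _).trans ?_
    refine (Finset.sum_le_sum fun i _ => abs_truncMul_le hδ.le _ _).trans ?_
    simp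
  have hint : Integrable (fun ω => Real.exp (r * (∑ i ∈ s, U i) ω)) P := by
    refine Integrable.of_bound (C := Real.exp (r * (s.card * δ)))
      (Real.measurable_exp.comp_aemeasurable (hmeas.const_mul r)).aestronglyMeasurable
      (ae_of_all _ fun ω => ?_)
    rw [Real.norm_eq_abs, Real.abs_exp]
    gcongr
    exact (abs_le.1 (hbdd ω)).2
  have hmgf : mgf (∑ i ∈ s, U i) P r ≤ Real.exp (r * M +
      (r / δ + r ^ 2 * Real.exp (r * δ)) * ((∑ i ∈ s, w i ^ 2) * σ)) := by
    rw [hUind.mgf_sum₀ (fun i => (hUid i).aemeasurable_fst)]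
    calc ∏ i ∈ s, mgf (U i) P r ≤ ∏ i ∈ s, Real.exp (r * w i * M +
          (r / δ + r ^ 2 * Real.exp (r * δ)) * w i ^ 2 * σ) := by
          refine Finset.prod_le_prod (fun i _ => mgf_nonneg) fun i _ => ?_
          have h1 : mgf (U i) P r = ∫ ω, Real.exp (r * truncMul δ (w i) (Y ω)) ∂P :=
            ((hUid i).comp (u := fun x => Real.exp (r * x)) (by fun_prop)).integral_eq
          rw [h1]
          exact integral_exp_mul_truncMul_le hY hY2 hδ hr (w i)
      _ = _ := by
          rw [← Real.exp_sum, Finset.sum_add_distrib, ← Finset.sum_mul, ← Finset.mul_sum, hw,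
            ← Finset.sum_mul, ← Finset.mul_sum]
          ring_nf
  refine (measure_mono hsub).trans ((measure_union_le _ _).trans (add_le_add ?_ ?_))
  · refine (measure_biUnion_finset_le _ _).trans (Finset.sum_le_sum fun i _ => le_of_eq ?_)
    exact (hid i).measure_mem_eq (s := {x | δ < |w i * x|})
      (measurableSet_lt measurable_const (by fun_prop))
  · rw [← ofReal_measureReal]
    refine ENNReal.ofReal_le_ofReal ((measure_ge_le_exp_mul_mgf _ hr hint).trans ?_)
    refine (mul_le_mul_of_nonneg_left hmgf (Real.exp_pos _).le).trans_eq ?_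
    rw [← Real.exp_add]
    ring_nf

/-! ### From deviations of a sum to large summands. -/

/-- If removing any single summand leaves the sum near `c` with probability at least `1/2`, then
the expected number of large summands is controlled by the deviation probability of the sum. -/
lemma sum_measureReal_le_of_sum_deviation [IsProbabilityMeasure P] {ι : Type*} [DecidableEq ι]
    {ξ : ι → Ω → ℝ} (hindep : iIndepFun ξ P) (hm : ∀ i, AEMeasurable (ξ i) P) (s : Finset ι)
    (c : ℝ) (hB : ∀ i ∈ s, 1 / 2 ≤ P.real {ω | |∑ j ∈ s.erase i, ξ j ω - c| ≤ 1}) :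
    ∑ i ∈ s, P.real {ω | 2 < |ξ i ω|} ≤
      4 * P.real {ω | 1 < |∑ i ∈ s, ξ i ω - c|} * (1 + ∑ i ∈ s, P.real {ω | 2 < |ξ i ω|}) := by
  set A : ι → Set Ω := fun i => {ω | 2 < |ξ i ω|} with hA
  set B : ι → Set Ω := fun i => {ω | |∑ j ∈ s.erase i, ξ j ω - c| ≤ 1} with hBdef
  set Q : Set Ω := {ω | 1 < |∑ i ∈ s, ξ i ω - c|} with hQ
  set p := ∑ i ∈ s, P.real (A i) with hp
  have hSm : ∀ t : Finset ι, AEMeasurable (fun ω => ∑ j ∈ t, ξ j ω - c) P := fun t =>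
    (Finset.aemeasurable_fun_sum t fun i _ => hm i).sub_const c
  have hAm : ∀ i, NullMeasurableSet (A i) P := fun i =>
    nullMeasurableSet_lt aemeasurable_const (hm i).abs
  have hBm : ∀ i, NullMeasurableSet (B i) P := fun i =>
    nullMeasurableSet_le (by fun_prop) aemeasurable_const
  have hQm : NullMeasurableSet Q P := nullMeasurableSet_lt aemeasurable_const (by fun_prop)
  have hEm : ∀ i, NullMeasurableSet (A i ∩ B i) P := fun i => (hAm i).inter (hBm i)
  have hp0 : 0 ≤ p := Finset.sum_nonneg fun i _ => measureReal_nonneg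
  have hAB : ∀ i ∈ s, P.real (A i) / 2 ≤ P.real (A i ∩ B i) := by
    intro i hi
    have h1 := (hindep.indepFun_finsetSum_of_notMem₀ hm (Finset.notMem_erase i s)).symm
    have h2 : P.real (A i ∩ B i) = P.real (A i) * P.real (B i) := by
      have h3 := h1.measure_inter_preimage_eq_mul {x | 2 < |x|} {x | |x - c| ≤ 1}
        (measurableSet_lt measurable_const (by fun_prop))
        (measurableSet_le (by fun_prop) measurable_const)
      have h4 : (∑ j ∈ s.erase i, ξ j) ⁻¹' {x | |x - c| ≤ 1} = B i := by
        ext ω; simp [hBdef]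
      rw [h4] at h3
      rw [measureReal_def, measureReal_def, measureReal_def, ← ENNReal.toReal_mul]
      exact congrArg ENNReal.toReal h3
    rw [h2]
    have := hB i hi
    have h5 : 0 ≤ P.real (A i) := measureReal_nonneg
    nlinarith
  have hAA : ∀ i j, P.real ((A i ∩ B i) ∩ (A j ∩ B j)) ≤
      P.real (A i) * P.real (A j) + if i = j then P.real (A i) else 0 := by
    intro i j
    have h5 : 0 ≤ P.real (A i) * P.real (A j) := mul_nonneg measureReal_nonneg measureReal_nonneg
    split_ifs with hij
    · have : P.real ((A i ∩ B i) ∩ (A j ∩ B j)) ≤ P.real (A i) :=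
        measureReal_mono fun ω hω => hω.1.1
      linarith
    · rw [add_zero]
      have h3 := (hindep.indepFun hij).measure_inter_preimage_eq_mul {x | 2 < |x|} {x | 2 < |x|}
        (measurableSet_lt measurable_const (by fun_prop))
        (measurableSet_lt measurable_const (by fun_prop))
      have h4 : P.real (A i ∩ A j) = P.real (A i) * P.real (A j) := by
        rw [measureReal_def, measureReal_def, measureReal_def, ← ENNReal.toReal_mul]
        exact congrArg ENNReal.toReal h3
      rw [← h4]
      exact measureReal_mono fun ω hω => ⟨hω.1.1, hω.2.1⟩
  -- `N` counts the large summands whose complementary sum is near `c`. It vanishes off `Q`, has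
  -- mean at least `p / 2`, and its second moment is at most `p² + p`.
  set N : Ω → ℝ := fun ω => ∑ i ∈ s, (A i ∩ B i).indicator 1 ω with hN
  have hind : ∀ {E : Set Ω}, NullMeasurableSet E P →
      Integrable (E.indicator (1 : Ω → ℝ)) P ∧ ∫ ω, E.indicator (1 : Ω → ℝ) ω ∂P = P.real E := by
    intro E hE
    refine ⟨(integrable_const (1 : ℝ)).indicator₀ hE, ?_⟩
    rw [integral_indicator₀ hE]
    simp
  have hN1 : Integrable N P := integrable_finsetSum _ fun i _ => (hind (hEm i)).1
  have hN1' : p / 2 ≤ ∫ ω, N ω ∂P := by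
    rw [hN, integral_finsetSum _ fun i _ => (hind (hEm i)).1, hp, Finset.sum_div]
    exact Finset.sum_le_sum fun i hi => (hAB i hi).trans_eq (hind (hEm i)).2.symm
  have hNsq : ∀ ω, N ω ^ 2 =
      ∑ i ∈ s, ∑ j ∈ s, ((A i ∩ B i) ∩ (A j ∩ B j)).indicator (1 : Ω → ℝ) ω := by
    intro ω
    rw [hN, sq, Finset.sum_mul_sum]
    refine Finset.sum_congr rfl fun i _ => Finset.sum_congr rfl fun j _ => ?_
    rw [Set.inter_indicator_one (s := A i ∩ B i)]
    rfl
  have hi2 : ∀ i j, Integrable (((A i ∩ B i) ∩ (A j ∩ B j)).indicator (1 : Ω → ℝ)) P := fun i j =>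
    (hind ((hEm i).inter (hEm j))).1
  have hN2 : Integrable (fun ω => N ω ^ 2) P := by
    simp_rw [hNsq]
    exact integrable_finsetSum _ fun i _ => integrable_finsetSum _ fun j _ => hi2 i j
  have hN2' : ∫ ω, N ω ^ 2 ∂P ≤ p ^ 2 + p := by
    simp_rw [hNsq]
    rw [integral_finsetSum _ fun i _ => integrable_finsetSum _ fun j _ => hi2 i j]
    calc _ = ∑ i ∈ s, ∑ j ∈ s, P.real ((A i ∩ B i) ∩ (A j ∩ B j)) := by
          refine Finset.sum_congr rfl fun i _ => ?_
          rw [integral_finsetSum _ fun j _ => hi2 i j]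
          exact Finset.sum_congr rfl fun j _ => (hind ((hEm i).inter (hEm j))).2
      _ ≤ ∑ i ∈ s, ∑ j ∈ s, (P.real (A i) * P.real (A j) + if i = j then P.real (A i) else 0) :=
          Finset.sum_le_sum fun i _ => Finset.sum_le_sum fun j _ => hAA i j
      _ = _ := by
          simp_rw [Finset.sum_add_distrib]
          rw [← Finset.sum_mul_sum, sq]
          simp [hp]
  -- On `Q` this is `(1 - l N)² ≥ 0`. It replaces Cauchy–Schwarz by a linear inequality with a free
  -- parameter.
  have hpt : ∀ (l : ℝ) ω, 2 * l * N ω - l ^ 2 * N ω ^ 2 ≤ Q.indicator (1 : Ω → ℝ) ω := by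
    intro l ω
    by_cases hω : ω ∈ Q
    · rw [Set.indicator_of_mem hω, Pi.one_apply]
      nlinarith [sq_nonneg (1 - l * N ω)]
    · have : N ω = 0 := by
        refine Finset.sum_eq_zero fun i hi => Set.indicator_of_notMem (fun h => hω ?_) _
        have h1 : 2 < |ξ i ω| := h.1
        have h2 : |∑ j ∈ s.erase i, ξ j ω - c| ≤ 1 := h.2
        rw [hQ, Set.mem_ofPred_eq, ← Finset.add_sum_erase s _ hi]
        have h3 := abs_sub (ξ i ω + ∑ j ∈ s.erase i, ξ j ω - c) (∑ j ∈ s.erase i, ξ j ω - c)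
        rw [show ξ i ω + ∑ j ∈ s.erase i, ξ j ω - c - (∑ j ∈ s.erase i, ξ j ω - c) = ξ i ω by
          ring] at h3
        linarith
      rw [Set.indicator_of_notMem hω, this]
      simp
  have hfin : ∀ l : ℝ, 0 ≤ l → l * p - l ^ 2 * (p ^ 2 + p) ≤ P.real Q := by
    intro l hl
    have h := integral_mono ((hN1.const_mul (2 * l)).sub (hN2.const_mul (l ^ 2))) (hind hQm).1
      (fun ω => hpt l ω)
    rw [(hind hQm).2, integral_sub' (hN1.const_mul (2 * l)) (hN2.const_mul (l ^ 2)),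
      integral_const_mul, integral_const_mul] at h
    nlinarith [mul_le_mul_of_nonneg_left hN1' hl, mul_le_mul_of_nonneg_left hN2' (sq_nonneg l)]
  -- This `l` maximizes `l p - l² (p² + p)`.
  have h1 := hfin (1 / (2 * (1 + p))) (by positivity)
  have e : 1 / (2 * (1 + p)) * p - (1 / (2 * (1 + p))) ^ 2 * (p ^ 2 + p) = p / (4 * (1 + p)) := by
    field_simp; ring
  rw [e, div_le_iff₀ (by positivity)] at h1
  linarith

/-! ### The sum of tail probabilities as an expected count. -/

lemma aemeasurable_triSum (a : ℝ) {f : Ω → ℝ → ℝ≥0∞}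
    (hf : ∀ t, AEMeasurable (fun ω => f ω t) P) : AEMeasurable (fun ω => triSum a (f ω)) P := by
  unfold triSum
  refine AEMeasurable.tsum fun m => AEMeasurable.tsum fun i => ?_
  split_ifs
  · exact hf _
  · exact aemeasurable_const

lemma lintegral_triSum (a : ℝ) {f : Ω → ℝ → ℝ≥0∞}
    (hf : ∀ t, AEMeasurable (fun ω => f ω t) P) :
    ∫⁻ ω, triSum a (f ω) ∂P = triSum a fun t => ∫⁻ ω, f ω t ∂P := by
  have h1 : ∀ m i : ℕ, AEMeasurable
      (fun ω => if i ≤ m then f ω (invWeight a m i) else 0) P := by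
    intro m i
    split_ifs
    · exact hf _
    · exact aemeasurable_const
  unfold triSum
  rw [lintegral_tsum fun m => AEMeasurable.tsum fun i => h1 m i]
  refine tsum_congr fun m => ?_
  rw [lintegral_tsum fun i => h1 m i]
  refine tsum_congr fun i => ?_
  split_ifs
  · rfl
  · simp

lemma tsum_sum_eq_triSum (a : ℝ) (f : ℝ → ℝ≥0∞) :
    ∑' m : ℕ, ∑ k ∈ Finset.range (m + 1), f (invWeight a m (m - k)) = triSum a f := by
  refine tsum_congr fun m => ?_
  have h := Finset.sum_range_reflect (fun i => f (invWeight a m i)) (m + 1)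
  simp only [Nat.add_sub_cancel] at h
  rw [h, tsum_eq_sum (s := Finset.range (m + 1))]
  · exact Finset.sum_congr rfl fun i hi => (if_pos (Nat.lt_succ_iff.1 (Finset.mem_range.1 hi))).symm
  · intro i hi
    exact if_neg fun h => hi (Finset.mem_range.2 (Nat.lt_succ_iff.2 h))

/-- The product of the reciprocal weights attached to the summand `q` of the `p`-th mean. -/
noncomputable def fieldInvWeight (α β : ℝ) (p q : ℕ × ℕ) : ℝ :=
  invWeight α p.1 (p.1 - q.1) * invWeight β p.2 (p.2 - q.2)

lemma fieldInvWeight_pos (α β : ℝ) (p q : ℕ × ℕ) : 0 < fieldInvWeight α β p q :=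
  mul_pos (invWeight_pos _ _ _) (invWeight_pos _ _ _)

/-- The normalized weight of the summand `q` in the `p`-th mean. -/
noncomputable def fieldWeight (α β : ℝ) (p q : ℕ × ℕ) : ℝ :=
  cesaroRatio α p.1 (p.1 - q.1) * cesaroRatio β p.2 (p.2 - q.2)

/-- The index set of the summands of the `p`-th mean. -/
def indexRect (p : ℕ × ℕ) : Finset (ℕ × ℕ) :=
  Finset.range (p.1 + 1) ×ˢ Finset.range (p.2 + 1)

lemma tsum_sum_indexRect (α β : ℝ) (f : ℝ → ℝ≥0∞) :
    ∑' p : ℕ × ℕ, ∑ q ∈ indexRect p, f (fieldInvWeight α β p q)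
      = triSum α fun s => triSum β fun t => f (s * t) := by
  rw [ENNReal.tsum_prod', ← tsum_sum_eq_triSum]
  refine tsum_congr fun m => ?_
  simp_rw [← tsum_sum_eq_triSum]
  rw [← Summable.tsum_finsetSum fun i _ => ENNReal.summable]
  exact tsum_congr fun n => Finset.sum_product _ _ _

lemma tsum_sum_measure_eq_lintegral {Y : Ω → ℝ} (hY : AEMeasurable Y P) (α β : ℝ) {c : ℝ}
    (hc : 0 < c) :
    ∑' p : ℕ × ℕ, ∑ q ∈ indexRect p, P {ω | c * fieldInvWeight α β p q < |Y ω|}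
      = ∫⁻ ω, weightCount α β (|Y ω| / c) ∂P := by
  have hE : ∀ t : ℝ, NullMeasurableSet {ω | t < |Y ω| / c} P := fun t =>
    nullMeasurableSet_lt aemeasurable_const (by fun_prop)
  have hm : ∀ t : ℝ, AEMeasurable (fun ω => if t < |Y ω| / c then (1 : ℝ≥0∞) else 0) P := by
    intro t
    have := (aemeasurable_const (b := (1 : ℝ≥0∞))).indicator₀ (hE t)
    refine this.congr (ae_of_all _ fun ω => ?_)
    simp [Set.indicator]
  have hint : ∀ t : ℝ, ∫⁻ ω, (if t < |Y ω| / c then (1 : ℝ≥0∞) else 0) ∂P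
      = P {ω | c * t < |Y ω|} := by
    intro t
    have h1 : {ω | c * t < |Y ω|} = {ω | t < |Y ω| / c} := by
      ext ω; simp only [Set.mem_ofPred_eq, lt_div_iff₀ hc, mul_comm c]
    rw [h1, ← lintegral_indicator_one₀ (hE t)]
    refine lintegral_congr fun ω => ?_
    simp [Set.indicator]
  rw [tsum_sum_indexRect α β fun t => P {ω | c * t < |Y ω|}]
  unfold weightCount
  rw [lintegral_triSum α fun s => aemeasurable_triSum β fun t => hm (s * t)]
  refine congrArg (triSum α) (funext fun s => ?_)
  rw [lintegral_triSum β fun t => hm (s * t)]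
  exact congrArg (triSum β) (funext fun t => (hint (s * t)).symm)

/-! ### Estimates for the two-parameter weights. -/

lemma fieldWeight_pos {α β : ℝ} (hα : 0 < α) (hβ : 0 < β) (p q : ℕ × ℕ) :
    0 < fieldWeight α β p q :=
  mul_pos (cesaroRatio_pos hα _ _) (cesaroRatio_pos hβ _ _)

lemma sum_fieldWeight {α β : ℝ} (hα : 0 < α) (hβ : 0 < β) (p : ℕ × ℕ) :
    ∑ q ∈ indexRect p, fieldWeight α β p q = 1 := by
  unfold indexRect fieldWeight
  rw [Finset.sum_product]
  simp only [← Finset.mul_sum, sum_cesaroRatio hβ, mul_one, sum_cesaroRatio hα]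

lemma fieldWeight_le {α β : ℝ} (hα : 0 < α) (hα1 : α ≤ 1) (hβ : 0 < β) (hβ1 : β ≤ 1)
    (p q : ℕ × ℕ) : fieldWeight α β p q ≤ Real.exp 2 / fieldInvWeight α β p q := by
  have h := mul_le_mul (cesaroRatio_le hα hα1 p.1 (p.1 - q.1))
    (cesaroRatio_le hβ hβ1 p.2 (p.2 - q.2)) (cesaroRatio_pos hβ _ _).le
    (div_pos (Real.exp_pos 1) (invWeight_pos _ _ _)).le
  refine h.trans_eq ?_
  rw [div_mul_div_comm, ← Real.exp_add]
  norm_num [fieldInvWeight]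

lemma le_fieldWeight {α β : ℝ} (hα : 0 < α) (hα1 : α ≤ 1) (hβ : 0 < β) (hβ1 : β ≤ 1)
    (p q : ℕ × ℕ) :
    α * β / Real.exp 2 / fieldInvWeight α β p q ≤ fieldWeight α β p q := by
  have h := mul_le_mul (le_cesaroRatio hα hα1 p.1 (p.1 - q.1))
    (le_cesaroRatio hβ hβ1 p.2 (p.2 - q.2))
    (div_pos (div_pos hβ (Real.exp_pos 1)) (invWeight_pos _ _ _)).le (cesaroRatio_pos hα _ _).le
  refine le_trans (le_of_eq ?_) h
  rw [div_mul_div_comm, div_mul_div_comm, ← Real.exp_add]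
  norm_num [fieldInvWeight]

lemma rpow_le_fieldInvWeight {α β : ℝ} (hαβ : α ≤ β) (hβ1 : β ≤ 1) (p q : ℕ × ℕ) :
    (((p.1 : ℝ) + 1) * ((p.2 : ℝ) + 1)) ^ α ≤ fieldInvWeight α β p q := by
  rw [Real.mul_rpow (by positivity) (by positivity)]
  have h1 := rpow_le_invWeight (hαβ.trans hβ1) p.1 (p.1 - q.1)
  have h2 := rpow_le_invWeight hβ1 p.2 (p.2 - q.2)
  have h3 : ((p.2 : ℝ) + 1) ^ α ≤ ((p.2 : ℝ) + 1) ^ β :=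
    Real.rpow_le_rpow_of_exponent_le (by linarith [(Nat.cast_nonneg p.2 : (0 : ℝ) ≤ p.2)]) hαβ
  exact mul_le_mul h1 (h3.trans h2) (by positivity) (invWeight_pos _ _ _).le

lemma fieldWeight_le_rpow {α β : ℝ} (hα : 0 < α) (hαβ : α ≤ β) (hβ1 : β ≤ 1) (p q : ℕ × ℕ) :
    fieldWeight α β p q ≤ Real.exp 2 * (((p.1 : ℝ) + 1) * ((p.2 : ℝ) + 1)) ^ (-α) := by
  refine (fieldWeight_le hα (hαβ.trans hβ1) (hα.trans_le hαβ) hβ1 p q).trans ?_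
  rw [Real.rpow_neg (by positivity), ← div_eq_mul_inv]
  gcongr
  exact rpow_le_fieldInvWeight hαβ hβ1 p q

/-- The largest weight times the total mass, which is one. -/
lemma sum_fieldWeight_sq_le {α β : ℝ} (hα : 0 < α) (hαβ : α ≤ β) (hβ1 : β ≤ 1) (p : ℕ × ℕ) :
    ∑ q ∈ indexRect p, fieldWeight α β p q ^ 2
      ≤ Real.exp 2 * (((p.1 : ℝ) + 1) * ((p.2 : ℝ) + 1)) ^ (-α) := by
  have hβ := hα.trans_le hαβ
  calc _ ≤ ∑ q ∈ indexRect p, Real.exp 2 * (((p.1 : ℝ) + 1) * ((p.2 : ℝ) + 1)) ^ (-α) *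
          fieldWeight α β p q := by
        refine Finset.sum_le_sum fun q _ => ?_
        rw [sq]
        exact mul_le_mul_of_nonneg_right (fieldWeight_le_rpow hα hαβ hβ1 p q)
          (fieldWeight_pos hα hβ p q).le
    _ = _ := by rw [← Finset.mul_sum, sum_fieldWeight hα hβ, mul_one]

lemma cesaroSum_deviation_iff {α β : ℝ} (hα : 0 < α) (hβ : 0 < β) (x : ℕ → ℕ → ℝ) (p : ℕ × ℕ)
    (c ε : ℝ) :
    |cesaroSum α β x p.1 p.2 - cesaroA α p.1 * cesaroA β p.2 * c|
        > cesaroA α p.1 * cesaroA β p.2 * ε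
      ↔ ε < |∑ q ∈ indexRect p, fieldWeight α β p q * x q.1 q.2 - c| := by
  have ha := cesaroA_pos hα.le p.1
  have hb := cesaroA_pos hβ.le p.2
  have hab := mul_pos ha hb
  have e : cesaroSum α β x p.1 p.2
      = cesaroA α p.1 * cesaroA β p.2 * ∑ q ∈ indexRect p, fieldWeight α β p q * x q.1 q.2 := by
    unfold cesaroSum indexRect
    rw [Finset.sum_product, Finset.mul_sum]
    refine Finset.sum_congr rfl fun k _ => ?_
    rw [Finset.mul_sum]
    refine Finset.sum_congr rfl fun l _ => ?_
    unfold fieldWeight cesaroRatio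
    field_simp
  rw [e, ← mul_sub, abs_mul, abs_of_pos hab, gt_iff_lt, mul_lt_mul_iff_right₀ hab]

/-! ### Moment conditions and the expected count. -/

/-- The growth function `x^p (log⁺ x)^k`. -/
noncomputable def growth (p : ℝ) (k : ℕ) (x : ℝ) : ℝ := x ^ p * logPlus x ^ k

lemma growth_nonneg {p : ℝ} {k : ℕ} {x : ℝ} (hx : 0 ≤ x) : 0 ≤ growth p k x := by
  have : 0 ≤ logPlus x := zero_le_one.trans (one_le_logPlus x)
  unfold growth; positivity

lemma measurable_growth (p : ℝ) (k : ℕ) : Measurable (growth p k) := by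
  unfold growth logPlus
  fun_prop

lemma logPlus_mono {x y : ℝ} (hx : 0 ≤ x) (hxy : x ≤ y) : logPlus x ≤ logPlus y := by
  rcases hx.eq_or_lt with rfl | hx
  · simp [logPlus]
  · exact max_le_max_right _ (Real.log_le_log hx hxy)

lemma growth_mono {p : ℝ} (hp : 0 ≤ p) (k : ℕ) {x y : ℝ} (hx : 0 ≤ x) (hxy : x ≤ y) :
    growth p k x ≤ growth p k y := by
  have h1 := logPlus_mono hx hxy
  have h2 : 0 ≤ logPlus x := zero_le_one.trans (one_le_logPlus x)
  have : 0 ≤ y := hx.trans hxy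
  unfold growth
  gcongr

lemma logPlus_div_le {x c : ℝ} (hx : 0 ≤ x) (hc : 0 < c) :
    logPlus (x / c) ≤ (1 + |Real.log c|) * logPlus x := by
  have h1 := one_le_logPlus x
  have h2 : Real.log x ≤ logPlus x := le_max_left _ _
  have h3 := abs_nonneg (Real.log c)
  refine max_le ?_ (by nlinarith)
  rcases hx.eq_or_lt with rfl | hx
  · rw [zero_div, Real.log_zero]; nlinarith
  · rw [Real.log_div hx.ne' hc.ne']
    nlinarith [neg_abs_le (Real.log c)]

/-- Rescaling the variable costs a constant factor, so the moment condition does not depend on the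
threshold `c`. -/
lemma growth_div_le (p : ℝ) (k : ℕ) {x c : ℝ} (hx : 0 ≤ x) (hc : 0 < c) :
    growth p k (x / c) ≤ (c ^ p)⁻¹ * (1 + |Real.log c|) ^ k * growth p k x := by
  have h2 : 0 ≤ logPlus (x / c) := zero_le_one.trans (one_le_logPlus _)
  unfold growth
  calc (x / c) ^ p * logPlus (x / c) ^ k
      ≤ (x / c) ^ p * ((1 + |Real.log c|) * logPlus x) ^ k := by
        gcongr; exact logPlus_div_le hx hc
    _ = _ := by rw [Real.div_rpow hx hc.le, mul_pow, div_eq_mul_inv]; ring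

lemma integrable_growth_div {Y : Ω → ℝ} (hYm : AEMeasurable Y P) {p : ℝ} {k : ℕ}
    (h : Integrable (fun ω => growth p k |Y ω|) P) {c : ℝ} (hc : 0 < c) :
    Integrable (fun ω => growth p k (|Y ω| / c)) P := by
  refine (h.const_mul ((c ^ p)⁻¹ * (1 + |Real.log c|) ^ k)).mono'
    ((measurable_growth p k).comp_aemeasurable (by fun_prop)).aestronglyMeasurable
    (ae_of_all _ fun ω => ?_)
  rw [Real.norm_of_nonneg (growth_nonneg (by positivity))]
  exact growth_div_le p k (abs_nonneg _) hc

lemma lintegral_weightCount_lt_top {Y : Ω → ℝ} (hYm : AEMeasurable Y P) {α β p : ℝ} {k : ℕ}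
    (hup : CountUpper α β p k) (h : Integrable (fun ω => growth p k |Y ω|) P) {c : ℝ}
    (hc : 0 < c) : ∫⁻ ω, weightCount α β (|Y ω| / c) ∂P < ∞ := by
  obtain ⟨C, hC, hCx⟩ := hup
  calc _ ≤ ∫⁻ ω, C * ENNReal.ofReal (growth p k (|Y ω| / c)) ∂P :=
        lintegral_mono fun ω => hCx _
    _ = C * ∫⁻ ω, ENNReal.ofReal (growth p k (|Y ω| / c)) ∂P := lintegral_const_mul' _ _ hC
    _ < ∞ := ENNReal.mul_lt_top hC.lt_top (integrable_growth_div hYm h hc).lintegral_lt_top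

lemma integrable_growth_of_lintegral [IsFiniteMeasure P] {Y : Ω → ℝ} (hYm : AEMeasurable Y P)
    {α β p : ℝ} {k : ℕ} (hp : 0 ≤ p) (hlow : CountLower α β p k) {c : ℝ} (hc : 0 < c)
    (h : ∫⁻ ω, weightCount α β (|Y ω| / c) ∂P < ∞) :
    Integrable (fun ω => growth p k |Y ω|) P := by
  obtain ⟨d, x₀, hd, hlow⟩ := hlow
  have hm : AEMeasurable (fun ω => |Y ω| / c) P := by fun_prop
  have hpt : ∀ x, 0 ≤ x → ENNReal.ofReal (d * growth p k x)
      ≤ weightCount α β x + ENNReal.ofReal (d * growth p k (max x₀ 0)) := by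
    intro x hx
    rcases le_total x₀ x with h1 | h1
    · exact (hlow x h1).trans le_self_add
    · refine le_trans (ENNReal.ofReal_le_ofReal ?_) le_add_self
      have := growth_mono hp k hx (h1.trans (le_max_left x₀ 0))
      gcongr
  have h1 : Integrable (fun ω => d * growth p k (|Y ω| / c)) P := by
    refine ⟨(((measurable_growth p k).comp_aemeasurable hm).const_mul d).aestronglyMeasurable, ?_⟩
    rw [hasFiniteIntegral_iff_ofReal
      (ae_of_all _ fun ω => mul_nonneg hd.le (growth_nonneg (by positivity)))]
    refine (lintegral_mono fun ω => hpt (|Y ω| / c) (by positivity)).trans_lt ?_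
    rw [lintegral_add_right _ measurable_const, lintegral_const]
    exact ENNReal.add_lt_top.2 ⟨h, ENNReal.mul_lt_top ENNReal.ofReal_lt_top (measure_lt_top _ _)⟩
  have h2 : Integrable (fun ω => growth p k |(|Y ω| / c)|) P := by
    have := h1.const_mul d⁻¹
    simp only [inv_mul_cancel_left₀ hd.ne'] at this
    refine this.congr (ae_of_all _ fun ω => ?_)
    beta_reduce
    rw [abs_of_nonneg (by positivity : 0 ≤ |Y ω| / c)]
  have h3 := integrable_growth_div hm h2 (inv_pos.2 hc)
  refine h3.congr (ae_of_all _ fun ω => ?_)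
  beta_reduce
  rw [abs_of_nonneg (by positivity : 0 ≤ |Y ω| / c)]
  congr 1
  field_simp

lemma integrable_sq_of_growth [IsFiniteMeasure P] {Y : Ω → ℝ} (hYm : AEMeasurable Y P) {p : ℝ}
    {k : ℕ} (hp : 2 ≤ p) (h : Integrable (fun ω => growth p k |Y ω|) P) :
    Integrable (fun ω => Y ω ^ 2) P := by
  refine ((integrable_const (1 : ℝ)).add h).mono' (by fun_prop) (ae_of_all _ fun ω => ?_)
  rw [Real.norm_of_nonneg (sq_nonneg _), Pi.add_apply, ← sq_abs]
  have h0 := abs_nonneg (Y ω)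
  rcases le_total |Y ω| 1 with h1 | h1
  · have := growth_nonneg (p := p) (k := k) h0
    nlinarith
  · have h2 : |Y ω| ^ 2 ≤ |Y ω| ^ p := by
      rw [← Real.rpow_two]; exact Real.rpow_le_rpow_of_exponent_le h1 hp
    have h3 : |Y ω| ^ p ≤ growth p k |Y ω| :=
      le_mul_of_one_le_right (by positivity) (one_le_pow₀ (one_le_logPlus _))
    linarith

lemma integrable_of_sq [IsFiniteMeasure P] {Y : Ω → ℝ} (hYm : AEMeasurable Y P)
    (h : Integrable (fun ω => Y ω ^ 2) P) : Integrable Y P :=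
  ((memLp_two_iff_integrable_sq hYm.aestronglyMeasurable).2 h).integrable one_le_two

/-! ### Sufficiency of the moment condition. -/

/-- With `r = (2/ε) log B` and `δ = α ε / 4`, `exp (-r ε)` is `B^(-2)` and `exp (r δ)` is only
`B^(α/2)`. The variance bound `B^(-α)` absorbs this and the powers of `log B`; `96 = 8 · 4 + 4 · 16`
collects the two terms. -/
lemma chernoff_exponent_le {α ε K V B : ℝ} (hα : 0 < α) (hε : 0 < ε) (hK : 0 ≤ K) (hB : 1 ≤ B)
    (hV : V ≤ K * B ^ (-α)) :
    -(2 / ε * Real.log B) * ε + (2 / ε * Real.log B / (α * ε / 4) +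
        (2 / ε * Real.log B) ^ 2 * Real.exp (2 / ε * Real.log B * (α * ε / 4))) * V
      ≤ 96 / (α ^ 2 * ε ^ 2) * K - 2 * Real.log B := by
  have hB0 : 0 < B := by linarith
  have hL : 0 ≤ Real.log B := Real.log_nonneg hB
  set L := Real.log B with hLdef
  have e1 : Real.exp (2 / ε * L * (α * ε / 4)) = B ^ (α / 2) := by
    rw [Real.rpow_def_of_pos hB0]; congr 1; field_simp; ring
  have h1 : L ≤ B ^ (α / 4) / (α / 4) := Real.log_le_rpow_div hB0.le (by positivity)
  have h2 : L * B ^ (-α) ≤ 4 / α := by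
    calc L * B ^ (-α) ≤ (B ^ α / (α / 4)) * B ^ (-α) := by
          gcongr
          refine h1.trans ?_
          gcongr
          linarith
      _ = (B ^ α * B ^ (-α)) * (4 / α) := by field_simp
      _ = 4 / α := by rw [← Real.rpow_add hB0]; simp
  have h3 : L ^ 2 * B ^ (α / 2) * B ^ (-α) ≤ 16 / α ^ 2 := by
    calc L ^ 2 * B ^ (α / 2) * B ^ (-α)
        ≤ (B ^ (α / 4) / (α / 4)) ^ 2 * B ^ (α / 2) * B ^ (-α) := by gcongr
      _ = (B ^ (α / 4) * B ^ (α / 4) * B ^ (α / 2) * B ^ (-α)) * (16 / α ^ 2) := by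
          field_simp; norm_num
      _ = 16 / α ^ 2 := by
          rw [← Real.rpow_add hB0, ← Real.rpow_add hB0, ← Real.rpow_add hB0]
          ring_nf
          simp
  rw [e1]
  have hc : 0 ≤ 2 / ε * L / (α * ε / 4) + (2 / ε * L) ^ 2 * B ^ (α / 2) := by positivity
  calc -(2 / ε * L) * ε + (2 / ε * L / (α * ε / 4) + (2 / ε * L) ^ 2 * B ^ (α / 2)) * V
      ≤ -(2 / ε * L) * ε + (2 / ε * L / (α * ε / 4) + (2 / ε * L) ^ 2 * B ^ (α / 2)) *
          (K * B ^ (-α)) := by gcongr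
    _ = 8 / (α * ε ^ 2) * (L * B ^ (-α)) * K +
          4 / ε ^ 2 * (L ^ 2 * B ^ (α / 2) * B ^ (-α)) * K - 2 * L := by field_simp; ring
    _ ≤ 8 / (α * ε ^ 2) * (4 / α) * K + 4 / ε ^ 2 * (16 / α ^ 2) * K - 2 * L := by gcongr
    _ = _ := by field_simp; ring

lemma tsum_ofReal_sq_ne_top :
    ∑' p : ℕ × ℕ, ENNReal.ofReal ((((p.1 : ℝ) + 1) * ((p.2 : ℝ) + 1)) ^ (-(2 : ℝ))) ≠ ∞ := by
  have h := tsum_ofReal_rpow_ne_top (s := 2) (by norm_num)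
  rw [ENNReal.tsum_prod']
  refine ne_of_eq_of_ne ?_ (ENNReal.mul_ne_top h h)
  rw [← ENNReal.tsum_mul_right]
  refine tsum_congr fun m => ?_
  rw [← ENNReal.tsum_mul_left]
  refine tsum_congr fun n => ?_
  rw [Real.mul_rpow (by positivity) (by positivity), ENNReal.ofReal_mul (by positivity)]

lemma measure_fieldWeight_sum_gt_le [IsProbabilityMeasure P] {α β : ℝ} (hα : 0 < α)
    (hαβ : α ≤ β) (hβ1 : β ≤ 1) {ξ : ℕ × ℕ → Ω → ℝ} {Y : Ω → ℝ} (hindep : iIndepFun ξ P)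
    (hid : ∀ i, IdentDistrib (ξ i) Y P P) (hY : Integrable Y P)
    (hY2 : Integrable (fun ω => Y ω ^ 2) P) {ε : ℝ} (hε : 0 < ε) (p : ℕ × ℕ) :
    P {ω | ε < ∑ q ∈ indexRect p, fieldWeight α β p q * ξ q ω - ∫ ω, Y ω ∂P} ≤
      ∑ q ∈ indexRect p, P {ω | α * ε / 4 / Real.exp 2 * fieldInvWeight α β p q < |Y ω|} +
      ENNReal.ofReal (Real.exp (96 / (α ^ 2 * ε ^ 2) * (Real.exp 2 * ∫ ω, Y ω ^ 2 ∂P))) *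
        ENNReal.ofReal ((((p.1 : ℝ) + 1) * ((p.2 : ℝ) + 1)) ^ (-(2 : ℝ))) := by
  have hβ := hα.trans_le hαβ
  set B := ((p.1 : ℝ) + 1) * ((p.2 : ℝ) + 1) with hBdef
  have hB : 1 ≤ B := by
    have h1 : (0 : ℝ) ≤ p.1 := Nat.cast_nonneg _
    have h2 : (0 : ℝ) ≤ p.2 := Nat.cast_nonneg _
    rw [hBdef]; nlinarith
  have hL : 0 ≤ Real.log B := Real.log_nonneg hB
  have hσ : 0 ≤ ∫ ω, Y ω ^ 2 ∂P := integral_nonneg fun ω => sq_nonneg _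
  refine (measure_weighted_sum_gt_le hindep hid (indexRect p) (fieldWeight α β p)
    (sum_fieldWeight hα hβ p) hY hY2 (δ := α * ε / 4) (r := 2 / ε * Real.log B)
    (by positivity) (by positivity) ε).trans (add_le_add ?_ ?_)
  · refine Finset.sum_le_sum fun q _ => measure_mono fun ω hω => ?_
    have hT := fieldInvWeight_pos α β p q
    have hw := fieldWeight_pos hα hβ p q
    simp only [Set.mem_ofPred_eq] at hω ⊢
    rw [abs_mul, abs_of_pos hw] at hω
    have h1 := hω.trans_le (mul_le_mul_of_nonneg_right
      (fieldWeight_le hα (hαβ.trans hβ1) hβ hβ1 p q) (abs_nonneg (Y ω)))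
    rw [div_mul_eq_mul_div, lt_div_iff₀ hT] at h1
    rw [div_mul_eq_mul_div, div_lt_iff₀ (Real.exp_pos 2)]
    linarith
  · rw [← ENNReal.ofReal_mul (Real.exp_pos _).le]
    refine ENNReal.ofReal_le_ofReal ?_
    have hV : (∑ q ∈ indexRect p, fieldWeight α β p q ^ 2) * ∫ ω, Y ω ^ 2 ∂P
        ≤ (Real.exp 2 * ∫ ω, Y ω ^ 2 ∂P) * B ^ (-α) := by
      refine (mul_le_mul_of_nonneg_right (sum_fieldWeight_sq_le hα hαβ hβ1 p) hσ).trans_eq ?_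
      ring
    rw [Real.rpow_def_of_pos (by linarith : 0 < B), ← Real.exp_add]
    refine Real.exp_le_exp.2 ((chernoff_exponent_le hα hε (by positivity) hB hV).trans_eq ?_)
    ring

lemma cesaroConvergesCompletely_of_lintegral [IsProbabilityMeasure P] {α β : ℝ} (hα : 0 < α)
    (hαβ : α ≤ β) (hβ1 : β ≤ 1) {X : ℕ → ℕ → Ω → ℝ} {Y : Ω → ℝ}
    (hindep : iIndepFun (fun p : ℕ × ℕ => X p.1 p.2) P)
    (hid : ∀ k l, IdentDistrib (X k l) Y P P) (hY2 : Integrable (fun ω => Y ω ^ 2) P)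
    (hcount : ∀ c : ℝ, 0 < c → ∫⁻ ω, weightCount α β (|Y ω| / c) ∂P < ∞) :
    CesaroConvergesCompletely P α β X (∫ ω, Y ω ∂P) := by
  intro ε hε
  have hYm : AEMeasurable Y P := (hid 0 0).aemeasurable_snd
  have hY := integrable_of_sq hYm hY2
  have hβ := hα.trans_le hαβ
  set c := α * ε / 4 / Real.exp 2 with hc
  have hc0 : 0 < c := by positivity
  set K := ENNReal.ofReal (Real.exp (96 / (α ^ 2 * ε ^ 2) * (Real.exp 2 * ∫ ω, Y ω ^ 2 ∂P)))
  set ξ : ℕ × ℕ → Ω → ℝ := fun p => X p.1 p.2 with hξ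
  have hneg : iIndepFun (fun p => -ξ p) P :=
    hindep.comp (fun _ x => -x) fun _ => measurable_neg
  have hle : ∀ p : ℕ × ℕ, P {ω | |cesaroSum α β (fun k l => X k l ω) p.1 p.2
        - cesaroA α p.1 * cesaroA β p.2 * ∫ ω, Y ω ∂P| > cesaroA α p.1 * cesaroA β p.2 * ε} ≤
      2 * (∑ q ∈ indexRect p, P {ω | c * fieldInvWeight α β p q < |Y ω|} +
        K * ENNReal.ofReal ((((p.1 : ℝ) + 1) * ((p.2 : ℝ) + 1)) ^ (-(2 : ℝ)))) := by
    intro p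
    have h1 := measure_fieldWeight_sum_gt_le hα hαβ hβ1 hindep (fun i => hid i.1 i.2) hY hY2 hε p
    have h2 := measure_fieldWeight_sum_gt_le hα hαβ hβ1 (Y := -Y) hneg
      (fun i => (hid i.1 i.2).comp measurable_neg) hY.neg (by simpa using hY2) hε p
    simp only [Pi.neg_apply, abs_neg, neg_sq] at h2
    rw [two_mul]
    refine le_trans (measure_mono ?_) ((measure_union_le _ _).trans (add_le_add h1 h2))
    intro ω hω
    rw [Set.mem_ofPred_eq, cesaroSum_deviation_iff hα hβ, lt_abs] at hω
    rcases hω with hω | hω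
    · exact Or.inl hω
    · refine Or.inr ?_
      simp only [Set.mem_ofPred_eq, mul_neg, Finset.sum_neg_distrib, integral_neg]
      linarith
  refine (ENNReal.tsum_le_tsum hle).trans_lt ?_
  rw [ENNReal.tsum_mul_left, ENNReal.tsum_add, tsum_sum_measure_eq_lintegral hYm α β hc0,
    ENNReal.tsum_mul_left]
  exact ENNReal.mul_lt_top ENNReal.ofNat_lt_top (ENNReal.add_lt_top.2 ⟨hcount c hc0,
    ENNReal.mul_lt_top ENNReal.ofReal_lt_top tsum_ofReal_sq_ne_top.lt_top⟩)

/-! ### Necessity of the moment condition. -/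

lemma exists_measure_lt_abs_lt [IsFiniteMeasure P] {Y : Ω → ℝ} (hYm : AEMeasurable Y P)
    {η : ℝ≥0∞} (hη : 0 < η) : ∃ t : ℝ, P {ω | t < |Y ω|} < η := by
  have h := tendsto_measure_iInter_atTop (μ := P) (s := fun n : ℕ => {ω | (n : ℝ) < |Y ω|})
    (fun n => nullMeasurableSet_lt aemeasurable_const (by fun_prop))
    (fun m n hmn ω hω => lt_of_le_of_lt (Nat.cast_le.2 hmn : (m : ℝ) ≤ n) hω) ⟨0, measure_ne_top _ _⟩
  have h0 : ⋂ n : ℕ, {ω | (n : ℝ) < |Y ω|} = ∅ := by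
    refine Set.eq_empty_of_forall_notMem fun ω hω => ?_
    obtain ⟨n, hn⟩ := exists_nat_ge |Y ω|
    exact absurd (Set.mem_iInter.1 hω n) (not_lt.2 hn)
  rw [h0, measure_empty] at h
  obtain ⟨n, hn⟩ := (h.eventually (gt_mem_nhds hη)).exists
  exact ⟨n, hn⟩

lemma finite_setOf_mul_le (K : ℝ) :
    {p : ℕ × ℕ | ((p.1 : ℝ) + 1) * ((p.2 : ℝ) + 1) ≤ K}.Finite := by
  refine (Finset.range (⌊K⌋₊ + 1) ×ˢ Finset.range (⌊K⌋₊ + 1)).finite_toSet.subset fun p hp => ?_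
  have h1 : (0 : ℝ) ≤ p.1 := Nat.cast_nonneg _
  have h2 : (0 : ℝ) ≤ p.2 := Nat.cast_nonneg _
  have hp : ((p.1 : ℝ) + 1) * ((p.2 : ℝ) + 1) ≤ K := hp
  simp only [Finset.coe_product, Finset.coe_range, Set.mem_prod, Set.mem_Iio, Nat.lt_succ_iff]
  exact ⟨Nat.le_floor (by nlinarith), Nat.le_floor (by nlinarith)⟩

lemma tsum_lt_top_of_finite_exceptions {ι : Type*} {f g : ι → ℝ≥0∞} {F : Set ι} (hF : F.Finite)
    (hf : ∀ i, f i ≠ ∞) (hg : ∑' i, g i ≠ ∞) (hfg : ∀ i, i ∉ F → f i ≤ g i) :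
    ∑' i, f i < ∞ := by
  have h : ∀ i, f i ≤ g i + F.indicator f i := by
    intro i
    by_cases hi : i ∈ F
    · rw [Set.indicator_of_mem hi]; exact le_add_self
    · exact (hfg i hi).trans le_self_add
  refine (ENNReal.tsum_le_tsum h).trans_lt ?_
  rw [ENNReal.tsum_add, tsum_eq_sum (s := hF.toFinset) fun i hi =>
    Set.indicator_of_notMem (fun h => hi (hF.mem_toFinset.2 h)) f]
  refine ENNReal.add_lt_top.2 ⟨hg.lt_top, ENNReal.sum_lt_top.2 fun i hi => ?_⟩
  rw [Set.indicator_of_mem (hF.mem_toFinset.1 hi)]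
  exact (hf i).lt_top

lemma sum_measure_le_eight_mul [IsProbabilityMeasure P] {ι : Type*} [DecidableEq ι]
    {ξ : ι → Ω → ℝ} (hindep : iIndepFun ξ P) (hm : ∀ i, AEMeasurable (ξ i) P) (s : Finset ι)
    (c : ℝ) (hS : P {ω | 1 / 2 < |∑ i ∈ s, ξ i ω - c|} < ENNReal.ofReal (1 / 8))
    (hξ : ∀ i ∈ s, P {ω | 1 / 2 < |ξ i ω|} < ENNReal.ofReal (1 / 8)) :
    ∑ i ∈ s, P {ω | 2 < |ξ i ω|} ≤ 8 * P {ω | 1 / 2 < |∑ i ∈ s, ξ i ω - c|} := by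
  have hSr : P.real {ω | 1 / 2 < |∑ i ∈ s, ξ i ω - c|} < 1 / 8 := by
    rw [← ofReal_measureReal] at hS
    exact (ENNReal.ofReal_lt_ofReal_iff (by norm_num)).1 hS
  have hB : ∀ i ∈ s, 1 / 2 ≤ P.real {ω | |∑ j ∈ s.erase i, ξ j ω - c| ≤ 1} := by
    intro i hi
    have h1 : P.real {ω | 1 / 2 < |ξ i ω|} < 1 / 8 := by
      have := hξ i hi
      rw [← ofReal_measureReal] at this
      exact (ENNReal.ofReal_lt_ofReal_iff (by norm_num)).1 this
    have h2 : (Set.univ : Set Ω) ⊆ {ω | |∑ j ∈ s.erase i, ξ j ω - c| ≤ 1} ∪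
        ({ω | 1 / 2 < |∑ i ∈ s, ξ i ω - c|} ∪ {ω | 1 / 2 < |ξ i ω|}) := by
      intro ω _
      by_contra h
      simp only [Set.mem_union, Set.mem_ofPred_eq, not_or, not_le, not_lt] at h
      obtain ⟨h3, h4, h5⟩ := h
      rw [← Finset.add_sum_erase s _ hi] at h4
      rw [abs_le] at h4 h5
      rw [lt_abs] at h3
      rcases h3 with h3 | h3 <;> linarith
    have h3 := measureReal_mono (μ := P) h2
    rw [probReal_univ] at h3
    have h4 := measureReal_union_le (μ := P) {ω | |∑ j ∈ s.erase i, ξ j ω - c| ≤ 1}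
      ({ω | 1 / 2 < |∑ i ∈ s, ξ i ω - c|} ∪ {ω | 1 / 2 < |ξ i ω|})
    have h5 := measureReal_union_le (μ := P) {ω | 1 / 2 < |∑ i ∈ s, ξ i ω - c|}
      {ω | 1 / 2 < |ξ i ω|}
    linarith
  have h := sum_measureReal_le_of_sum_deviation hindep hm s c hB
  have hq : P.real {ω | 1 < |∑ i ∈ s, ξ i ω - c|} ≤ P.real {ω | 1 / 2 < |∑ i ∈ s, ξ i ω - c|} :=
    measureReal_mono fun ω hω => lt_trans (by norm_num : (1 / 2 : ℝ) < 1) hω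
  have hp0 : 0 ≤ ∑ i ∈ s, P.real {ω | 2 < |ξ i ω|} :=
    Finset.sum_nonneg fun i _ => measureReal_nonneg
  have hmain : ∑ i ∈ s, P.real {ω | 2 < |ξ i ω|}
      ≤ 8 * P.real {ω | 1 / 2 < |∑ i ∈ s, ξ i ω - c|} := by
    -- From `p ≤ 4 q (1 + p)` and `q < 1/8` the term `4 q p` is at most `p / 2`, hence `p ≤ 8 q`.
    nlinarith
  have h6 := ENNReal.ofReal_le_ofReal hmain
  rw [ENNReal.ofReal_sum_of_nonneg fun i _ => measureReal_nonneg,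
    ENNReal.ofReal_mul (by norm_num)] at h6
  have e : ∀ E : Set Ω, ENNReal.ofReal (P.real E) = P E := fun E => ofReal_measureReal
  simpa only [e, ENNReal.ofReal_ofNat] using h6

lemma lintegral_weightCount_of_convergesCompletely [IsProbabilityMeasure P] {α β : ℝ} (hα : 0 < α)
    (hαβ : α ≤ β) (hβ1 : β ≤ 1) {X : ℕ → ℕ → Ω → ℝ} {Y : Ω → ℝ}
    (hindep : iIndepFun (fun p : ℕ × ℕ => X p.1 p.2) P)
    (hid : ∀ k l, IdentDistrib (X k l) Y P P) {μ : ℝ}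
    (h : CesaroConvergesCompletely P α β X μ) :
    ∫⁻ ω, weightCount α β (|Y ω| / (2 * Real.exp 2 / (α * β))) ∂P < ∞ := by
  have hYm : AEMeasurable Y P := (hid 0 0).aemeasurable_snd
  have hβ := hα.trans_le hαβ
  have hconv := h (1 / 2) (by norm_num)
  simp only [cesaroSum_deviation_iff hα hβ] at hconv
  set D : ℕ × ℕ → ℝ≥0∞ := fun p =>
    P {ω | 1 / 2 < |∑ q ∈ indexRect p, fieldWeight α β p q * X q.1 q.2 ω - μ|} with hD
  have h8 : (0 : ℝ≥0∞) < ENNReal.ofReal (1 / 8) := ENNReal.ofReal_pos.2 (by norm_num)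
  have hDfin : {p | ¬ D p < ENNReal.ofReal (1 / 8)}.Finite :=
    (ENNReal.tendsto_cofinite_zero_of_tsum_ne_top hconv.ne).eventually (gt_mem_nhds h8)
  obtain ⟨t, ht⟩ := exists_measure_lt_abs_lt hYm h8
  -- Beyond this `K` every weight is so small that a weighted summand above `1/2` forces `|Y| > t`;
  -- only finitely many means are excluded.
  set K := (2 * Real.exp 2 * max t 0) ^ (1 / α) with hK
  have hFfin := hDfin.union (finite_setOf_mul_le K)
  rw [← tsum_sum_measure_eq_lintegral hYm α β (by positivity)]
  refine tsum_lt_top_of_finite_exceptions (g := fun p => 8 * D p) hFfin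
    (fun p => (ENNReal.sum_lt_top.2 fun q _ => measure_lt_top _ _).ne)
    (by rw [ENNReal.tsum_mul_left]; exact ENNReal.mul_ne_top ENNReal.ofNat_ne_top hconv.ne)
    fun p hp => ?_
  simp only [Set.mem_union, Set.mem_ofPred_eq, not_or, not_not, not_le] at hp
  obtain ⟨hp1, hp2⟩ := hp
  have hid' : ∀ (a c : ℝ) (q : ℕ × ℕ),
      P {ω | c < |a * X q.1 q.2 ω|} = P {ω | c < |a * Y ω|} := fun a c q =>
    (hid q.1 q.2).measure_mem_eq (s := {x | c < |a * x|})
      (measurableSet_lt measurable_const (by fun_prop))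
  have hmain := sum_measure_le_eight_mul (ξ := fun q ω => fieldWeight α β p q * X q.1 q.2 ω)
    (hindep.comp (fun q x => fieldWeight α β p q * x) fun q => by fun_prop)
    (fun q => (hid q.1 q.2).aemeasurable_fst.const_mul _) (indexRect p) μ hp1 ?_
  · refine le_trans (Finset.sum_le_sum fun q _ => ?_) hmain
    rw [hid']
    refine measure_mono fun ω hω => ?_
    have hT := fieldInvWeight_pos α β p q
    have hw := fieldWeight_pos hα hβ p q
    simp only [Set.mem_ofPred_eq] at hω ⊢
    rw [abs_mul, abs_of_pos hw]
    refine lt_of_lt_of_le ?_ (mul_le_mul_of_nonneg_right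
      (le_fieldWeight hα (hαβ.trans hβ1) hβ hβ1 p q) (abs_nonneg (Y ω)))
    rw [div_mul_eq_mul_div, div_lt_iff₀ (by positivity)] at hω
    rw [div_div, div_mul_eq_mul_div, lt_div_iff₀ (by positivity)]
    linarith
  · intro q _
    rw [hid']
    refine lt_of_le_of_lt (measure_mono fun ω hω => ?_) ht
    have hw := fieldWeight_pos hα hβ p q
    simp only [Set.mem_ofPred_eq] at hω ⊢
    rw [abs_mul, abs_of_pos hw] at hω
    have h1 := hω.trans_le (mul_le_mul_of_nonneg_right
      (fieldWeight_le_rpow hα hαβ hβ1 p q) (abs_nonneg (Y ω)))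
    set B := ((p.1 : ℝ) + 1) * ((p.2 : ℝ) + 1) with hB
    have hB0 : 0 < B := by positivity
    have h2 : 2 * Real.exp 2 * max t 0 < B ^ α := by
      have := Real.rpow_lt_rpow (by positivity) hp2 hα
      rwa [hK, ← Real.rpow_mul (by positivity), one_div_mul_cancel hα.ne', Real.rpow_one] at this
    rw [Real.rpow_neg hB0.le, ← div_eq_mul_inv, div_mul_eq_mul_div,
      lt_div_iff₀ (by positivity)] at h1
    have h3 : Real.exp 2 * max t 0 < Real.exp 2 * |Y ω| := by linarith
    exact (le_max_left t 0).trans_lt (lt_of_mul_lt_mul_left h3 (Real.exp_pos 2).le)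

/-! ### Uniqueness of the limit and conclusion. -/

lemma CesaroConvergesCompletely.unique [IsProbabilityMeasure P] {α β : ℝ} (hα : 0 < α)
    (hβ : 0 < β) {X : ℕ → ℕ → Ω → ℝ} {μ ν : ℝ} (h1 : CesaroConvergesCompletely P α β X μ)
    (h2 : CesaroConvergesCompletely P α β X ν) : μ = ν := by
  by_contra hne
  have hε : 0 < |μ - ν| / 3 := div_pos (abs_pos.2 (sub_ne_zero.2 hne)) (by norm_num)
  have g1 := h1 _ hε
  have g2 := h2 _ hε
  simp only [cesaroSum_deviation_iff hα hβ] at g1 g2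
  have h8 : (0 : ℝ≥0∞) < ENNReal.ofReal (1 / 2) := ENNReal.ofReal_pos.2 (by norm_num)
  obtain ⟨p, hp1, hp2⟩ := (((ENNReal.tendsto_cofinite_zero_of_tsum_ne_top g1.ne).eventually
    (gt_mem_nhds h8)).and ((ENNReal.tendsto_cofinite_zero_of_tsum_ne_top g2.ne).eventually
    (gt_mem_nhds h8))).exists
  have h3 : (Set.univ : Set Ω) ⊆
      {ω | |μ - ν| / 3 < |∑ q ∈ indexRect p, fieldWeight α β p q * X q.1 q.2 ω - μ|} ∪
      {ω | |μ - ν| / 3 < |∑ q ∈ indexRect p, fieldWeight α β p q * X q.1 q.2 ω - ν|} := by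
    intro ω _
    by_contra h
    simp only [Set.mem_union, Set.mem_ofPred_eq, not_or, not_lt] at h
    have h' := abs_sub_le μ (∑ q ∈ indexRect p, fieldWeight α β p q * X q.1 q.2 ω) ν
    rw [abs_sub_comm μ (∑ q ∈ indexRect p, _)] at h'
    linarith
  have h4 := (measure_mono h3).trans (measure_union_le (μ := P) _ _)
  rw [measure_univ] at h4
  have h5 := h4.trans_lt (ENNReal.add_lt_add hp1 hp2)
  rw [← ENNReal.ofReal_add (by norm_num) (by norm_num)] at h5
  norm_num at h5

lemma convergesCompletely_iff [IsProbabilityMeasure P] {α β : ℝ} (hα : 0 < α)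
    (hαβ : α ≤ β) (hβ1 : β ≤ 1) {X : ℕ → ℕ → Ω → ℝ} {Y : Ω → ℝ}
    (hindep : iIndepFun (fun p : ℕ × ℕ => X p.1 p.2) P)
    (hid : ∀ k l, IdentDistrib (X k l) Y P P) {p : ℝ} {k : ℕ} (hp : 2 ≤ p)
    (hup : CountUpper α β p k) (hlow : CountLower α β p k) (μ : ℝ) :
    CesaroConvergesCompletely P α β X μ ↔
      Integrable (fun ω => |Y ω| ^ p * logPlus |Y ω| ^ k) P ∧ Integrable Y P ∧
        ∫ ω, Y ω ∂P = μ := by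
  have hYm : AEMeasurable Y P := (hid 0 0).aemeasurable_snd
  have hβ := hα.trans_le hαβ
  have hsuff : Integrable (fun ω => growth p k |Y ω|) P →
      CesaroConvergesCompletely P α β X (∫ ω, Y ω ∂P) := fun h =>
    cesaroConvergesCompletely_of_lintegral hα hαβ hβ1 hindep hid
      (integrable_sq_of_growth hYm hp h) fun c hc => lintegral_weightCount_lt_top hYm hup h hc
  constructor
  · intro h
    have hg : Integrable (fun ω => growth p k |Y ω|) P :=
      integrable_growth_of_lintegral hYm (by linarith) hlow (by positivity)
        (lintegral_weightCount_of_convergesCompletely hα hαβ hβ1 hindep hid h)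
    exact ⟨hg, integrable_of_sq hYm (integrable_sq_of_growth hYm hp hg),
      (hsuff hg).unique hα hβ h⟩
  · rintro ⟨hg, -, rfl⟩
    exact hsuff hg

end Probability

/-- Under the hypotheses on `α` and `β`, exactly one of the five implications has true premises; the
other four hold vacuously. -/
theorem mainTheorem4 {Ω : Type*} [MeasurableSpace Ω] (P : Measure Ω) [IsProbabilityMeasure P]
    (α β : ℝ) (hα : 0 < α) (hαβ : α ≤ β) (hβ : β ≤ 1)
    (X : ℕ → ℕ → Ω → ℝ) (Y : Ω → ℝ)
    (hindep : iIndepFun (fun p : ℕ × ℕ => X p.1 p.2) P)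
    (hident : ∀ k l : ℕ, IdentDistrib (X k l) Y P P)
    (μ : ℝ) :
    CesaroConvergesCompletely P α β X μ ↔
      ((α < 1 / 2 → α < β → Integrable (fun ω => |Y ω| ^ (1 / α)) P) ∧
       (α = β → α < 1 / 2 → Integrable (fun ω => |Y ω| ^ (1 / α) * logPlus |Y ω|) P) ∧
       (α = β → α = 1 / 2 → Integrable (fun ω => |Y ω| ^ 2 * logPlus |Y ω| ^ 3) P) ∧
       (α = 1 / 2 → 1 / 2 < β → Integrable (fun ω => |Y ω| ^ 2 * logPlus |Y ω| ^ 2) P) ∧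
       (1 / 2 < α → Integrable (fun ω => |Y ω| ^ 2 * logPlus |Y ω|) P)) ∧
      Integrable Y P ∧ ∫ ω, Y ω ∂P = μ := by
  have key := fun (p : ℝ) (k : ℕ) (hp : 2 ≤ p) (hup : CountUpper α β p k)
    (hlow : CountLower α β p k) =>
    convergesCompletely_iff hα hαβ hβ hindep hident hp hup hlow μ
  rcases lt_trichotomy α (1 / 2) with h | h | h
  · have hp : 2 ≤ 1 / α := by rw [le_div_iff₀ hα]; linarith
    rcases hαβ.eq_or_lt with heq | hlt
    · have hk := key (1 / α) 1 hp (heq ▸ countUpper_eq_lt_half hα h)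
        (heq ▸ countLower_eq_lt_half hα)
      simp only [pow_one] at hk
      exact hk.trans (and_congr_left' ⟨fun hi => ⟨fun _ h' => absurd heq h'.ne, fun _ _ => hi,
        fun _ h' => absurd h' h.ne, fun h' => absurd h' h.ne, fun h' => absurd h' h.not_gt⟩,
        fun hc => hc.2.1 heq h⟩)
    · have hk := key (1 / α) 0 hp (countUpper_lt_half hα h hlt hβ) (countLower_zero hα)
      simp only [pow_zero, mul_one] at hk
      exact hk.trans (and_congr_left' ⟨fun hi => ⟨fun _ _ => hi, fun h' => absurd h' hlt.ne,
        fun h' => absurd h' hlt.ne, fun h' => absurd h' h.ne, fun h' => absurd h' h.not_gt⟩,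
        fun hc => hc.1 h hlt⟩)
  · rcases hαβ.eq_or_lt with heq | hlt
    · have hk := key 2 3 le_rfl (by rw [← heq, h]; exact countUpper_half_half)
        (by rw [← heq, h]; exact countLower_half_half)
      simp only [Real.rpow_two] at hk
      exact hk.trans (and_congr_left' ⟨fun hi => ⟨fun h' => absurd h h'.ne,
        fun _ h' => absurd h h'.ne, fun _ _ => hi,
        fun _ h' => absurd (h.symm.trans heq) h'.ne, fun h' => absurd h h'.ne'⟩,
        fun hc => hc.2.2.1 heq h⟩)
    · have hb : 1 / 2 < β := h ▸ hlt
      have hk := key 2 2 le_rfl (by rw [h]; exact countUpper_half_lt hb hβ)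
        (by rw [h]; exact countLower_half_lt hβ)
      simp only [Real.rpow_two] at hk
      exact hk.trans (and_congr_left' ⟨fun hi => ⟨fun h' => absurd h h'.ne,
        fun h' => absurd h' hlt.ne, fun h' => absurd h' hlt.ne, fun _ _ => hi,
        fun h' => absurd h h'.ne'⟩, fun hc => hc.2.2.2.1 h hb⟩)
  · have hk := key 2 1 le_rfl
      (countUpper_gt_half h (hαβ.trans hβ) (h.trans_le hαβ) hβ)
      (countLower_two_one (hαβ.trans hβ) (hα.trans_le hαβ) hβ)
    simp only [Real.rpow_two, pow_one] at hk
    exact hk.trans (and_congr_left' ⟨fun hi => ⟨fun h' => absurd h' h.not_gt,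
      fun _ h' => absurd h' h.not_gt, fun _ h' => absurd h' h.ne', fun h' => absurd h' h.ne',
      fun _ => hi⟩, fun hc => hc.2.2.2.2 h⟩)
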